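/- A \emph{limit group} is a finitely generated, fully residually free group. A \emph{GAD} (generalized abelian decomposition) of a group $H$ is a finite graph of groups decomposition $\Delta$ of $H$ with abelian edge groups in which each vertex group is marked rigid, abelian or QH; a vertex group marked abelian is abelian, and a vertex group marked QH is the fundamental group of a compact surface with boundary that contains two intersecting essential simple closed curves, with every incident edge group conjugate to a boundary subgroup. An edge of $\Delta$ carries the one-edged splitting of $H$ obtained by collapsing all other edges. A one-edged splitting over an abelian group $C$ is \emph{essential} if no vertex group is cyclic and, in the case of an amalgam $A*_CB$, the group $C$ has infinite index in $A$ and in $B$ (for cyclic $C\neq 1$ in a torsion-free group the second condition follows from the first). Let $G$ and $H$ be freely indecomposable limit groups and let $\eta\colon G\to H$ be a homomorphism such that $\eta^*\colon H^1(H;\mathbb{Z})\to H^1(G;\mathbb{Z})$ is injective. Let $G$ act through $\eta$ on the Bass--Serre trees of decompositions of $H$. (1) $G$ is hyperbolic in every essential one-edged abelian splitting of $H$, that is, $G$ fixes no vertex of its Bass--Serre tree. (2) If $R$ is a nonabelian vertex group of a GAD of $H$, then $\eta^{-1}(hRh^{-1})$ is nonabelian for some $h\in H$. (If $\eta$ is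 injective, this says that $G$ meets a conjugate of $R$ in a nonabelian subgroup.) (3) Let $\Delta_H$ be a GAD of $H$ with Bass--Serre tree $T$, let $S\subseteq T$ be a minimal $G$-invariant subtree, and let $\Delta_G=S/G$ be the induced decomposition of $G$, whose vertex groups are the stabilizers in $G$ of the vertices of $S$. Let $R$ be a nonabelian vertex group of $\Delta_H$, and suppose that exactly one vertex $R'$ of $\Delta_G$ with nonabelian vertex group maps to $R$. Then for every edge $e$ of $\Delta_H$ starting at $R$ that carries an essential splitting, there is an edge $e'$ of $\Delta_G$ starting at $R'$ whose image in $\Delta_H$ has an edge group with the same centralizer in $R$ as that of $e$, up to conjugacy in $R$. Consequently, if all edges of $\Delta_H$ starting at $R$ carry essential splittings and distinct such edges have nonconjugate centralizers in $R$, then the map of underlying graphs $\Delta_G\to\Delta_H$ is a submersion at $R'$: every edge of $\Delta_H$ starting at $R$ is the image of an edge of $\Delta_G$ starting at $R'$. (An edge whose two ends are both at $R$ counts as two edges starting at $R$.) -/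

import Mathlib

/-- A limit group: a finitely generated, fully residually free group. -/
def IsLimitGroup (G : Type*) [Group G] : Prop :=
  Group.FG G ∧
    ∀ S : Finset G, ∃ (n : ℕ) (f : G →* FreeGroup (Fin n)), Set.InjOn f (S : Set G)

/-- `G` is freely indecomposable: whenever `G` is the internal free product of two subgroups,
one of them is trivial. -/
def IsFreelyIndecomposable (G : Type*) [Group G] : Prop :=
  ∀ A B : Subgroup G,
    Function.Bijective (Monoid.Coprod.lift A.subtype B.subtype) → A = ⊥ ∨ B = ⊥

/-- Injectivity of `H¹(H; ℤ) → H¹(G; ℤ)`, where `H¹(-; ℤ) = Hom(-, ℤ)` and the map is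
precomposition with `η`. -/
def H1Injective {G H : Type*} [Group G] [Group H] (η : G →* H) : Prop :=
  Function.Injective (fun φ : H →* Multiplicative ℤ => φ.comp η)

/-- A subgroup that is not abelian. -/
def IsNonabelian {G : Type*} [Group G] (K : Subgroup G) : Prop :=
  ∃ x ∈ K, ∃ y ∈ K, x * y ≠ y * x

/-- The conjugate `g K g⁻¹`. -/
def conjSubgroup {G : Type*} [Group G] (g : G) (K : Subgroup G) : Subgroup G :=
  K.map (MulAut.conj g).toMonoidHom

/-- An action of `H` without inversions on a simplicial tree with vertex set `V`. By Bass-Serre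
theory this is the same as a graph of groups decomposition of `H`: the underlying graph is the
quotient, and the vertex and edge groups are the stabilizers. -/
structure TreeAction (H : Type*) [Group H] (V : Type*) [MulAction H V] where
  graph : SimpleGraph V
  isTree : graph.IsTree
  adj_smul : ∀ (h : H) {u v : V}, graph.Adj u v → graph.Adj (h • u) (h • v)
  no_inversion : ∀ (h : H) {u v : V}, graph.Adj u v → ¬ (h • u = v ∧ h • v = u)

/-- The stabilizer of the edge joining `u` and `v` (for an action without inversions). -/
def edgeGroup (H : Type*) [Group H] {V : Type*} [MulAction H V] (u v : V) : Subgroup H :=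
  MulAction.stabilizer H u ⊓ MulAction.stabilizer H v

namespace TreeAction

variable {H : Type*} [Group H] {V : Type*} [MulAction H V]

/-- All edge groups are abelian. -/
def HasAbelianEdgeGroups (T : TreeAction H V) : Prop :=
  ∀ u v : V, T.graph.Adj u v → ¬ IsNonabelian (edgeGroup H u v)

/-- The quotient graph has exactly one edge, that is, the decomposition has the form
`A *_C B` or `A *_C`. -/
def IsOneEdged (T : TreeAction H V) : Prop :=
  (∃ u v : V, T.graph.Adj u v) ∧
    ∀ u v u' v' : V, T.graph.Adj u v → T.graph.Adj u' v' →
      ∃ h : H, (h • u = u' ∧ h • v = v') ∨ (h • u = v' ∧ h • v = u')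

/-- The forest obtained from the tree by deleting the orbit of the edge `{a, b}`. Its components
are the vertices of the tree of the one-edged decomposition obtained by collapsing all edges
outside that orbit. -/
def cutForest (T : TreeAction H V) (a b : V) : SimpleGraph V :=
  T.graph.deleteEdges {e | ∃ h : H, e = s(h • a, h • b)}

theorem cutForest_adj_smul (T : TreeAction H V) (a b : V) (h : H) {u v : V}
    (huv : (T.cutForest a b).Adj u v) : (T.cutForest a b).Adj (h • u) (h • v) := by
  unfold cutForest at *
  rw [SimpleGraph.deleteEdges_adj] at *
  refine ⟨T.adj_smul h huv.1, ?_⟩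
  rintro ⟨k, hk⟩
  apply huv.2
  refine ⟨h⁻¹ * k, ?_⟩
  have := congrArg (Sym2.map (fun x : V => h⁻¹ • x)) hk
  simpa [mul_smul] using this

theorem cutForest_reachable_smul (T : TreeAction H V) (a b : V) (h : H) {u v : V}
    (huv : (T.cutForest a b).Reachable u v) :
    (T.cutForest a b).Reachable (h • u) (h • v) :=
  huv.map ⟨fun x => h • x, fun hx => T.cutForest_adj_smul a b h hx⟩

/-- The stabilizer of the component of `x` in `cutForest a b`: the vertex group at `x` of the
one-edged decomposition obtained by collapsing all edges outside the orbit of `{a, b}`. -/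
def sideGroup (T : TreeAction H V) (a b x : V) : Subgroup H where
  carrier := {h | (T.cutForest a b).Reachable x (h • x)}
  one_mem' := by simp
  mul_mem' := by
    intro h k hh hk
    have := T.cutForest_reachable_smul a b h hk
    rw [← mul_smul] at this
    exact SimpleGraph.Reachable.trans hh this
  inv_mem' := by
    intro h hh
    have := T.cutForest_reachable_smul a b h⁻¹ hh
    rw [inv_smul_smul] at this
    exact this.symm

/-- The one-edged decomposition of `H` carried by the edge `{a, b}` is an amalgam `A *_C B`
(and not an HNN extension): the two endpoints lie in different orbits after collapsing. -/
def IsSeparatingEdge (T : TreeAction H V) (a b : V) : Prop :=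
  ∀ h : H, ¬ (T.cutForest a b).Reachable a (h • b)

/-- The one-edged decomposition of `H` obtained by collapsing all edges outside the orbit of
`{a, b}` is essential: no vertex group is cyclic and, if it is an amalgam `A *_C B`, then `C` has
infinite index in `A` and in `B` (`relIndex` is `0` exactly when the index is infinite). For a
cyclic group `C` in a torsion-free group the second condition follows from the first. -/
def IsEssentialEdge (T : TreeAction H V) (a b : V) : Prop :=
  ¬ IsCyclic (T.sideGroup a b a) ∧ ¬ IsCyclic (T.sideGroup a b b) ∧
    (T.IsSeparatingEdge a b →
      (edgeGroup H a b).relIndex (T.sideGroup a b a) = 0 ∧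
      (edgeGroup H a b).relIndex (T.sideGroup a b b) = 0)

/-- In a one-edged decomposition the side groups are the vertex groups. -/
theorem sideGroup_eq_stabilizer (T : TreeAction H V) (hT : T.IsOneEdged) {a b : V}
    (hab : T.graph.Adj a b) (x : V) : T.sideGroup a b x = MulAction.stabilizer H x := by
  have hbot : T.cutForest a b = ⊥ := by
    ext u v
    simp only [cutForest, SimpleGraph.deleteEdges_adj, SimpleGraph.bot_adj, iff_false]
    rintro ⟨huv, hn⟩
    apply hn
    obtain ⟨h, hh | hh⟩ := hT.2 a b u v hab huv
    · exact ⟨h, by rw [hh.1, hh.2]⟩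
    · exact ⟨h, by rw [hh.1, hh.2, Sym2.eq_swap]⟩
  ext h
  change (T.cutForest a b).Reachable x (h • x) ↔ h • x = x
  rw [hbot, SimpleGraph.reachable_bot, eq_comm]

/-- An essential one-edged abelian splitting of `H`. -/
def IsEssentialOneEdgedAbelianSplitting (T : TreeAction H V) : Prop :=
  T.IsOneEdged ∧ T.HasAbelianEdgeGroups ∧
    ∀ a b : V, T.graph.Adj a b → T.IsEssentialEdge a b

/-- `G`, acting through `η`, is elliptic: it fixes a vertex. -/
def IsElliptic {G : Type*} [Group G] (_T : TreeAction H V) (η : G →* H) : Prop :=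
  ∃ v : V, ∀ g : G, η g • v = v

/-- `G`, acting through `η`, is hyperbolic: it is not elliptic. -/
def IsHyperbolic {G : Type*} [Group G] (T : TreeAction H V) (η : G →* H) : Prop :=
  ¬ T.IsElliptic η

/-- The vertex group at `v` of the decomposition of `G` induced by `η`: the stabilizer of `v`
in `G`. -/
def inducedVertexGroup {G : Type*} [Group G] (_T : TreeAction H V) (η : G →* H) (v : V) :
    Subgroup G :=
  (MulAction.stabilizer H v).comap η

/-- `S` is (the vertex set of) a subtree that is invariant under `G`. -/
def IsInvariantSubtree {G : Type*} [Group G] (T : TreeAction H V) (η : G →* H)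
    (S : Set V) : Prop :=
  (T.graph.induce S).Connected ∧ ∀ (g : G), ∀ v ∈ S, η g • v ∈ S

/-- `S` is a minimal `G`-invariant subtree. The decomposition of `G` induced by `T` has
underlying graph `S / G`, which maps to `T / H`. -/
def IsMinimalSubtree {G : Type*} [Group G] (T : TreeAction H V) (η : G →* H)
    (S : Set V) : Prop :=
  T.IsInvariantSubtree η S ∧ ∀ S' ⊆ S, T.IsInvariantSubtree η S' → S' = S

/-- Up to the action of `G`, the vertex `w` is the only vertex of `S` that lies over the vertex
of `T / H` represented by `w` and has nonabelian stabilizer in `G`. -/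
def IsUniqueNonabelianOver {G : Type*} [Group G] (T : TreeAction H V) (η : G →* H)
    (S : Set V) (w : V) : Prop :=
  w ∈ S ∧ IsNonabelian (T.inducedVertexGroup η w) ∧
    ∀ w' ∈ S, (∃ h : H, h • w = w') → IsNonabelian (T.inducedVertexGroup η w') →
      ∃ g : G, η g • w = w'

/-- The map of graphs `S / G → T / H` is a submersion at the vertex represented by `w`: every
edge of `T / H` starting at the image of `w` is the image of an edge of `S / G` starting at `w`.
Edges of `T / H` starting at the image of `w` are the orbits of the stabilizer of `w` on the
neighbours of `w` in `T`. -/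
def IsSubmersionAt (T : TreeAction H V) (S : Set V) (w : V) : Prop :=
  ∀ u : V, T.graph.Adj w u →
    ∃ u' ∈ S, T.graph.Adj w u' ∧ ∃ h : H, h • w = w ∧ h • u' = u

/-- The centralizer, in the vertex group of `w`, of the group of the edge `{w, u}`. -/
def edgeCentralizer (_T : TreeAction H V) (w u : V) : Subgroup H :=
  Subgroup.centralizer (edgeGroup H w u : Set H) ⊓ MulAction.stabilizer H w

/-- The edges `{w, u}` and `{w, u'}` have centralizers that are conjugate in the vertex group
of `w`. -/
def HaveConjugateCentralizers (T : TreeAction H V) (w u u' : V) : Prop :=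
  ∃ r ∈ MulAction.stabilizer H w,
    T.edgeCentralizer w u' = conjSubgroup r (T.edgeCentralizer w u)

/-- Distinct edges of `T / H` starting at the vertex of `w` have centralizers that are not
conjugate in the vertex group of `w`. -/
def HasNonconjugateCentralizersAt (T : TreeAction H V) (w : V) : Prop :=
  ∀ u u' : V, T.graph.Adj w u → T.graph.Adj w u' → T.HaveConjugateCentralizers w u u' →
    ∃ h : H, h • w = w ∧ h • u = u'

end TreeAction

/-- Homeomorphism types of compact connected surfaces: orientable of genus `g` with `b` boundary
components, or a sphere with `k` crosscaps and `b` boundary components. -/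
inductive SurfaceType where
  | orientable (g b : ℕ)
  | nonorientable (k b : ℕ)

namespace SurfaceType

/-- The number of boundary components. -/
def numBoundary : SurfaceType → ℕ
  | orientable _ b => b
  | nonorientable _ b => b

/-- Handle generators (two per handle) or crosscap generators. -/
def Core : SurfaceType → Type
  | orientable g _ => Fin g × Bool
  | nonorientable k _ => Fin k

/-- The product of commutators, or of squares, of the core generators. -/
def coreWord : (S : SurfaceType) → FreeGroup S.Core
  | orientable g _ =>
      let x : Fin g → FreeGroup (Fin g × Bool) := fun i => FreeGroup.of (i, false)
      let y : Fin g → FreeGroup (Fin g × Bool) := fun i => FreeGroup.of (i, true)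
      ((List.finRange g).map fun i => x i * y i * (x i)⁻¹ * (y i)⁻¹).prod
  | nonorientable k _ =>
      let x : Fin k → FreeGroup (Fin k) := fun i => FreeGroup.of i
      ((List.finRange k).map fun i => x i ^ 2).prod

/-- The relator of the standard presentation of the fundamental group. -/
def relator (S : SurfaceType) : FreeGroup (S.Core ⊕ Fin S.numBoundary) :=
  FreeGroup.map Sum.inl S.coreWord *
    ((List.finRange S.numBoundary).map fun j => FreeGroup.of (Sum.inr j)).prod

/-- The fundamental group. -/
abbrev Pi1 (S : SurfaceType) : Type := PresentedGroup {S.relator}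

/-- The element represented by the `j`-th boundary component. -/
def boundary (S : SurfaceType) (j : Fin S.numBoundary) : S.Pi1 :=
  PresentedGroup.of (Sum.inr j)

/-- The surface has nonempty boundary and contains two essential simple closed curves that
intersect: it has negative Euler characteristic and is not a pair of pants. -/
def IsQHType : SurfaceType → Prop
  | orientable g b => 1 ≤ b ∧ (1 ≤ g ∨ 4 ≤ b)
  | nonorientable k b => 1 ≤ b ∧ 1 ≤ k ∧ 3 ≤ k + b

end SurfaceType

/-- The possible marks of a vertex of a generalized abelian decomposition. -/
inductive VertexMark where
  | rigid
  | abelian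
  | qh

/-- A generalized abelian decomposition (GAD) of `H`, given by its Bass-Serre tree: a finite graph
of groups with abelian edge groups, each vertex group being marked rigid, abelian or QH. A vertex
group marked QH is identified with the fundamental group of a surface in such a way that all
incident edge groups are conjugate to boundary subgroups. -/
structure GAD (H : Type*) [Group H] (V : Type*) [MulAction H V] extends TreeAction H V where
  finite_vertices : Finite (MulAction.orbitRel.Quotient H V)
  finite_edges : ∃ F : Set (V × V), F.Finite ∧
    ∀ u v : V, graph.Adj u v → ∃ h : H, (h • u, h • v) ∈ F
  abelian_edges : toTreeAction.HasAbelianEdgeGroups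
  mark : V → VertexMark
  mark_smul : ∀ (h : H) (v : V), mark (h • v) = mark v
  mark_abelian : ∀ v : V, mark v = VertexMark.abelian →
    ¬ IsNonabelian (MulAction.stabilizer H v)
  mark_qh : ∀ v : V, mark v = VertexMark.qh →
    ∃ S : SurfaceType, S.IsQHType ∧ ∃ φ : S.Pi1 ≃* MulAction.stabilizer H v,
      ∀ u : V, graph.Adj v u → ∃ (j : Fin S.numBoundary) (q : MulAction.stabilizer H v),
        edgeGroup H v u =
          conjSubgroup (q : H) (Subgroup.zpowers (φ (S.boundary j) : H))

/-!
Write `L` for the image of `G` in `H`. Injectivity on first cohomology says that no nonzero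
homomorphism from `H` to the integers kills `L`, and each of the three assertions is proved by
producing such a homomorphism from the assumption that it fails.

The source of homomorphisms is `TreeAction.not_forall_mem_sideGroup`: suppose that `H` acts on a
tree with an edge `{a, b}` whose group `C` is abelian, and that `L` lies in the vertex group `A` of
`a` in the one-edged splitting carried by this edge. If the splitting is an HNN extension, count
translates of the edge with sign. If it is an amalgam `A *_C B`, extend by zero on `A` a nonzero
homomorphism on `B` killing `C`. For nonabelian `B` this exists because `B` has nonabelian
image in some free group, in which the image of `C` is cyclic
(`IsLimitGroup.exists_hom_int_of_isNonabelian`); for abelian `B` it exists as soon as `C` has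
infinite index, since `B / C` is a quotient of `H` and hence finitely generated. The Bass-Serre
theory needed is integration of crossed homomorphisms over the tree
(`TreeAction.exists_hom_of_cocycle`), which rests on the existence of potentials for labellings of
the oriented edges of a tree.

This proves the first assertion. For the other two the tree is blown up: each vertex `v` becomes a
star, and an edge `{v, u}` is attached to the leaf given by the centralizer, in the vertex
group of `v`, of its edge group (`TreeAction.blowUp`). The edges of the stars at centralizers
of nontrivial edge groups have abelian groups, because such centralizers are malnormal in vertex
groups of a limit group. If the preimage of some vertex group is abelian, then `η` is injective,
as `G` is nonabelian and has no nontrivial abelian normal subgroups, and since `G` is freely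
indecomposable the edges of a minimal subtree have nontrivial stabilizers in `G`
(`TreeAction.IsMinimalSubtree.exists_ne_one`). So at a vertex with abelian stabilizer
in `G` all edges of the subtree have commuting nontrivial stabilizers, hence the same centralizer, and
the lift of the subtree to the blow-up turns at a leaf without passing
through the center of the star. If all vertices of the subtree over a vertex of the quotient
have abelian stabilizers, or if the centralizer of an edge `e` is not met at the only
nonabelian one, the lift avoids all translates of an edge of a star, and `L` lies in one side of the
splitting which that edge carries. The other side is large: in the second assertion it contains the
nonabelian vertex group; in the third, if `e` is separating, essentiality of `e` gives infinite
index. If `e` does not separate but the edge of the star does, counting translates of `e` with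
sign already kills `L`.
-/

/-! ### Potentials on trees -/

namespace SimpleGraph

/-- A labelling of the oriented edges of a tree by a group, inverted when the orientation is
reversed, is the coboundary of a function on the vertices. -/
theorem IsTree.exists_potential {V K : Type*} [Group K] {X : SimpleGraph V} (hX : X.IsTree)
    (l : V → V → K) (hl : ∀ u v, X.Adj u v → l v u = (l u v)⁻¹) :
    ∃ p : V → K, ∀ u v, X.Adj u v → p v = p u * l u v := by
  classical
  obtain ⟨x⟩ := hX.connected.nonempty
  choose q hq hq' using hX.existsUnique_path x
  let W : ∀ {u v : V}, X.Walk u v → K := fun w => (w.darts.map fun d => l d.fst d.snd).prod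
  have concat_eq : ∀ {u v : V} (huv : X.Adj u v), v ∉ (q u).support →
      W (q v) = W (q u) * l u v := by
    intro u v huv hv
    rw [← hq' v _ ((hq u).concat hv huv)]
    simp [W, Walk.concat_eq_append, Walk.darts_append]
  refine ⟨fun v => W (q v), fun u v huv => ?_⟩
  by_cases hv : v ∈ (q u).support
  · have hu : u ∉ (q v).support := by
      intro hu
      -- Both initial segments are the distinguished paths, so each is strictly shorter than
      -- the other.
      have h1 := hq' v _ ((hq u).takeUntil hv)
      have h2 := hq' u _ ((hq v).takeUntil hu)
      have h3 := Walk.length_takeUntil_lt_length hv huv.ne.symm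
      have h4 := Walk.length_takeUntil_lt_length hu huv.ne
      rw [h1] at h3
      rw [h2] at h4
      omega
    change W (q v) = W (q u) * l u v
    rw [concat_eq huv.symm hu, hl u v huv]
    group
  · exact concat_eq huv hv

/-- Conversely, a connected graph on which all integral labellings have potentials is a tree:
a path joining the ends of an edge `e` outside `e` is an obstruction for the indicator of `e`. -/
theorem isTree_of_exists_potential {V : Type*} {X : SimpleGraph V} (hX : X.Connected)
    (h : ∀ l : V → V → Multiplicative ℤ, (∀ u v, X.Adj u v → l v u = (l u v)⁻¹) →
      ∃ p : V → Multiplicative ℤ, ∀ u v, X.Adj u v → p v = p u * l u v) : X.IsTree := by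
  classical
  refine ⟨hX, isAcyclic_iff_forall_adj_isBridge.2 fun u v huv => ?_⟩
  rw [isBridge_iff]
  intro hr
  have huv' := huv.ne
  obtain ⟨p, hp⟩ := h (fun x y => if x = u ∧ y = v then Multiplicative.ofAdd 1
    else if x = v ∧ y = u then Multiplicative.ofAdd (-1) else 1) (by
      intro x y _
      by_cases h1 : x = u ∧ y = v
      · obtain ⟨rfl, rfl⟩ := h1
        simp [huv', huv'.symm]
      · by_cases h2 : x = v ∧ y = u
        · obtain ⟨rfl, rfl⟩ := h2
          simp [huv', huv'.symm]
        · have h3 : ¬ (y = u ∧ x = v) := fun h => h2 h.symm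
          have h4 : ¬ (y = v ∧ x = u) := fun h => h1 h.symm
          simp [h1, h2, h3, h4])
  have hpc : ∀ x y, (X.deleteEdges {s(u, v)}).Reachable x y → p x = p y := by
    rintro x y ⟨w⟩
    induction w with
    | nil => rfl
    | cons hxy _ ih =>
      rw [deleteEdges_adj] at hxy
      rw [← ih, hp _ _ hxy.1]
      have := hxy.2
      simp only [Set.mem_singleton_iff, Sym2.eq_iff, not_or] at this
      simp [this.1, this.2]
  have h1 := hp u v huv
  rw [← hpc u v hr] at h1
  simp only [and_self, if_true, left_eq_mul] at h1
  exact absurd h1 (by decide)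

/-- A function that is constant along edges is constant on components. -/
theorem Reachable.eq_of_forall_adj {V α : Type*} {X : SimpleGraph V} {f : V → α}
    (hf : ∀ u v, X.Adj u v → f u = f v) {u v : V} (h : X.Reachable u v) : f u = f v := by
  obtain ⟨w⟩ := h
  induction w with
  | nil => rfl
  | cons h _ ih => exact (hf _ _ h).trans ih

end SimpleGraph

/-! ### Homomorphisms out of a group acting on a tree -/

namespace TreeAction

variable {H : Type*} [Group H] {V : Type*} [MulAction H V]

theorem cutForest_comm (T : TreeAction H V) (a b : V) : T.cutForest a b = T.cutForest b a := by
  simp only [cutForest, Sym2.eq_swap]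

theorem isSeparatingEdge_comm (T : TreeAction H V) {a b : V} (h : T.IsSeparatingEdge a b) :
    T.IsSeparatingEdge b a := by
  intro g hg
  rw [cutForest_comm] at hg
  have := T.cutForest_reachable_smul a b g⁻¹ hg
  rw [inv_smul_smul] at this
  exact h _ this.symm

theorem mem_sideGroup {T : TreeAction H V} {a b x : V} {h : H} :
    h ∈ T.sideGroup a b x ↔ (T.cutForest a b).Reachable x (h • x) := Iff.rfl

theorem stabilizer_le_sideGroup (T : TreeAction H V) (a b x : V) :
    MulAction.stabilizer H x ≤ T.sideGroup a b x := by
  intro h hh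
  rw [mem_sideGroup, MulAction.mem_stabilizer_iff.1 hh]

theorem mem_edgeGroup {u v : V} {h : H} : h ∈ edgeGroup H u v ↔ h • u = u ∧ h • v = v := by
  simp [edgeGroup, Subgroup.mem_inf]

theorem edgeGroup_comm (u v : V) : edgeGroup H u v = edgeGroup H v u := inf_comm _ _

/-- An edge of the tree survives in the forest or is a translate of the removed edge. -/
theorem cutForest_adj_or (T : TreeAction H V) (a b : V) {u v : V} (huv : T.graph.Adj u v) :
    (T.cutForest a b).Adj u v ∨ (∃ g : H, u = g • a ∧ v = g • b) ∨
      ∃ g : H, u = g • b ∧ v = g • a := by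
  by_cases h : ∃ g : H, s(u, v) = s(g • a, g • b)
  · obtain ⟨g, hg⟩ := h
    rcases Sym2.eq_iff.1 hg with hg | hg
    · exact Or.inr (Or.inl ⟨g, hg⟩)
    · exact Or.inr (Or.inr ⟨g, hg⟩)
  · left
    rw [cutForest, SimpleGraph.deleteEdges_adj]
    exact ⟨huv, h⟩

/-- A crossed homomorphism `c` from `H` to the `K`-valued functions on the vertices which are
constant on the components of the forest, together with a label `l` for the edge `{a, b}`
compatible with `c` on the edge group, integrates to a homomorphism `H → K`. This contains the
universal properties of amalgams and of HNN extensions. -/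
theorem exists_hom_of_cocycle (T : TreeAction H V) {a b : V} (hab : T.graph.Adj a b)
    {K : Type*} [Group K] (c : H → V → K)
    (hc : ∀ g h v, c (g * h) v = c g (h • v) * c h v)
    (hF : ∀ h u v, (T.cutForest a b).Adj u v → c h u = c h v)
    (l : K) (hl : ∀ e ∈ edgeGroup H a b, c e a * l = l * c e b) :
    ∃ (φ : H →* K) (p : V → K), p a = 1 ∧ p b = l ∧
      (∀ u v, (T.cutForest a b).Reachable u v → p u = p v) ∧
      ∀ h v, φ h = p (h • v) * c h v * (p v)⁻¹ := by
  classical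
  have c_one : ∀ v, c 1 v = 1 := by
    intro v
    have := hc 1 1 v
    rw [one_smul, one_mul] at this
    exact left_eq_mul.1 this
  have c_inv : ∀ g v, c g⁻¹ (g • v) = (c g v)⁻¹ := by
    intro g v
    have := hc g⁻¹ g v
    rw [inv_mul_cancel, c_one] at this
    exact eq_inv_of_mul_eq_one_left this.symm
  let m : H → K := fun g => c g a * l * (c g b)⁻¹
  have m_eq : ∀ g g' : H, g • a = g' • a → g • b = g' • b → m g = m g' := by
    intro g g' h1 h2
    have he : g'⁻¹ * g ∈ edgeGroup H a b := by
      rw [mem_edgeGroup, mul_smul, mul_smul, h1, h2]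
      simp
    have h3 := hl _ he
    rw [hc, hc, h1, h2, c_inv, c_inv] at h3
    have h4 : c g a * l = c g' a * (l * ((c g' b)⁻¹ * c g b)) := by
      rw [← h3]; group
    change c g a * l * (c g b)⁻¹ = c g' a * l * (c g' b)⁻¹
    rw [h4]
    group
  have no_flip : ∀ g g' : H, ¬ (g • a = g' • b ∧ g • b = g' • a) := by
    rintro g g' ⟨h1, h2⟩
    refine T.no_inversion (g'⁻¹ * g) hab ⟨?_, ?_⟩
    · rw [mul_smul, h1, inv_smul_smul]
    · rw [mul_smul, h2, inv_smul_smul]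
  let L : V → V → K := fun u v =>
    if h : ∃ g : H, u = g • a ∧ v = g • b then m h.choose
    else if h : ∃ g : H, u = g • b ∧ v = g • a then (m h.choose)⁻¹ else 1
  have L_ab : ∀ g : H, L (g • a) (g • b) = m g := by
    intro g
    have h : ∃ g' : H, g • a = g' • a ∧ g • b = g' • b := ⟨g, rfl, rfl⟩
    simp only [L, dif_pos h]
    exact (m_eq _ _ h.choose_spec.1 h.choose_spec.2).symm
  have L_ba : ∀ g : H, L (g • b) (g • a) = (m g)⁻¹ := by
    intro g
    have h : ∃ g' : H, g • b = g' • b ∧ g • a = g' • a := ⟨g, rfl, rfl⟩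
    have h' : ¬ ∃ g' : H, g • b = g' • a ∧ g • a = g' • b :=
      fun ⟨g', h1, h2⟩ => no_flip g g' ⟨h2, h1⟩
    simp only [L, dif_neg h', dif_pos h]
    rw [m_eq _ _ h.choose_spec.2 h.choose_spec.1]
  have L_forest : ∀ u v, (T.cutForest a b).Adj u v → L u v = 1 := by
    intro u v huv
    rw [cutForest, SimpleGraph.deleteEdges_adj] at huv
    have h1 : ¬ ∃ g : H, u = g • a ∧ v = g • b := by
      rintro ⟨g, rfl, rfl⟩
      exact huv.2 ⟨g, rfl⟩
    have h2 : ¬ ∃ g : H, u = g • b ∧ v = g • a := by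
      rintro ⟨g, rfl, rfl⟩
      exact huv.2 ⟨g, Sym2.eq_swap⟩
    simp only [L, dif_neg h1, dif_neg h2]
  obtain ⟨p₀, hp₀⟩ := T.isTree.exists_potential L (by
    intro u v huv
    rcases T.cutForest_adj_or a b huv with h | ⟨g, rfl, rfl⟩ | ⟨g, rfl, rfl⟩
    · rw [L_forest _ _ h, L_forest _ _ h.symm, inv_one]
    · rw [L_ab, L_ba]
    · rw [L_ab, L_ba, inv_inv])
  obtain ⟨p, hp, hpa⟩ : ∃ p : V → K,
      (∀ u v, T.graph.Adj u v → p v = p u * L u v) ∧ p a = 1 :=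
    ⟨fun v => (p₀ a)⁻¹ * p₀ v, fun u v huv => by simp only [hp₀ u v huv, mul_assoc], by simp⟩
  have p_forest : ∀ u v, (T.cutForest a b).Adj u v → p u = p v := by
    intro u v huv
    rw [hp u v (SimpleGraph.deleteEdges_le _ huv), L_forest _ _ huv, mul_one]
  have p_edge : ∀ g : H, p (g • b) = p (g • a) * m g := by
    intro g
    rw [hp _ _ (T.adj_smul g hab), L_ab]
  have q_edge : ∀ h g : H, p (h • g • b) * c h (g • b) * (p (g • b))⁻¹ =
      p (h • g • a) * c h (g • a) * (p (g • a))⁻¹ := by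
    intro h g
    have h1 := p_edge (h * g)
    simp only [m, mul_smul, hc] at h1
    rw [h1, p_edge]
    simp only [m]
    group
  have q_const : ∀ h u v, p (h • u) * c h u * (p u)⁻¹ = p (h • v) * c h v * (p v)⁻¹ := by
    intro h u v
    refine (T.isTree.connected.preconnected u v).eq_of_forall_adj
      (f := fun v => p (h • v) * c h v * (p v)⁻¹) ?_
    intro u v huv
    rcases T.cutForest_adj_or a b huv with hf | ⟨g, rfl, rfl⟩ | ⟨g, rfl, rfl⟩
    · simp only [p_forest _ _ hf, p_forest _ _ (T.cutForest_adj_smul a b h hf), hF h _ _ hf]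
    · exact (q_edge h g).symm
    · exact q_edge h g
  refine ⟨MonoidHom.mk' (fun h => p (h • a) * c h a * (p a)⁻¹) ?_, p, hpa, ?_, ?_, ?_⟩
  · intro g h
    rw [q_const g a (h • a), mul_smul, hc]
    group
  · have := p_edge 1
    simpa [m, c_one, hpa] using this
  · exact fun u v huv => huv.eq_of_forall_adj p_forest
  · exact fun h v => q_const h a v

/-- A homomorphism defined on the stabilizer of a component of the forest induces a crossed
homomorphism on `H` supported by the orbit of this component. -/
theorem exists_cocycle (T : TreeAction H V) (a b x : V) {K : Type*} [Group K]
    (ψ : T.sideGroup a b x →* K) :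
    ∃ c : H → V → K, (∀ g h v, c (g * h) v = c g (h • v) * c h v) ∧
      (∀ h u v, (T.cutForest a b).Adj u v → c h u = c h v) ∧
      (∀ h : T.sideGroup a b x, c h x = ψ h) ∧
      ∀ h v, (¬ ∃ g : H, (T.cutForest a b).Reachable (g • x) v) → c h v = 1 := by
  classical
  set F := T.cutForest a b
  let A : Subgroup H := T.sideGroup a b x
  let P : V → H → Prop := fun v g => F.Reachable (g • x) v
  have P_eq : ∀ u v, F.Reachable u v → P u = P v := by
    intro u v huv
    ext g
    exact ⟨fun h => h.trans huv, fun h => h.trans huv.symm⟩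
  have P_smul : ∀ h v g, P v g → P (h • v) (h * g) := by
    intro h v g hg
    have := T.cutForest_reachable_smul a b h hg
    rwa [← mul_smul] at this
  -- A choice of coset representatives, trivial on the component of `x`.
  let s : V → H := fun v => if P v 1 then 1 else Classical.epsilon (P v)
  have s_eq : ∀ u v, F.Reachable u v → s u = s v := by
    intro u v huv
    simp only [s, P_eq u v huv]
  have s_spec : ∀ v, (∃ g, P v g) → P v (s v) := by
    intro v hv
    by_cases h : P v 1
    · simp only [s, if_pos h]; exact h
    · simp only [s, if_neg h]; exact Classical.epsilon_spec hv
  have mem : ∀ (h : H) (v : V), (∃ g, P v g) → (s (h • v))⁻¹ * h * s v ∈ A := by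
    intro h v hv
    have h1 := P_smul h v _ (s_spec v hv)
    have h2 := s_spec (h • v) ⟨_, h1⟩
    have h3 : F.Reachable (s (h • v) • x) ((h * s v) • x) := h2.trans h1.symm
    have := T.cutForest_reachable_smul a b (s (h • v))⁻¹ h3
    rwa [inv_smul_smul, ← mul_smul, ← mul_assoc] at this
  let ψ' : H → K := fun h => if hh : h ∈ A then ψ ⟨h, hh⟩ else 1
  have ψ'_mul : ∀ g ∈ A, ∀ h ∈ A, ψ' (g * h) = ψ' g * ψ' h := by
    intro g hg h hh
    simp only [ψ', dif_pos hg, dif_pos hh, dif_pos (A.mul_mem hg hh), ← map_mul]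
    rfl
  have P_iff : ∀ (h : H) (v : V), (∃ g, P (h • v) g) ↔ ∃ g, P v g := by
    intro h v
    refine ⟨fun ⟨g, hg⟩ => ⟨h⁻¹ * g, ?_⟩, fun ⟨g, hg⟩ => ⟨_, P_smul h v g hg⟩⟩
    simpa using P_smul h⁻¹ _ _ hg
  refine ⟨fun h v => if ∃ g, P v g then ψ' ((s (h • v))⁻¹ * h * s v) else 1, ?_, ?_, ?_, ?_⟩
  · intro g h v
    by_cases hv : ∃ g, P v g
    · simp only [if_pos hv, P_iff]
      rw [← ψ'_mul _ (mem g (h • v) ((P_iff h v).2 hv)) _ (mem h v hv), mul_smul]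
      congr 1
      group
    · simp only [if_neg hv, P_iff, mul_one]
  · intro h u v huv
    simp only [P_eq u v huv.reachable, s_eq u v huv.reachable,
      s_eq _ _ (T.cutForest_adj_smul a b h huv).reachable]
  · rintro ⟨h, hh⟩
    have h1 : P x 1 := by simp only [P, one_smul]; exact SimpleGraph.Reachable.refl _
    have h2 : s x = 1 := if_pos h1
    have h3 : s (h • x) = 1 := by rw [← s_eq _ _ (mem_sideGroup.1 hh), h2]
    simp only [if_pos (⟨1, h1⟩ : ∃ g, P x g), h2, h3, inv_one, one_mul, mul_one, ψ']
    exact dif_pos hh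
  · intro h v hv
    exact if_neg hv

/-- For a separating edge, homomorphisms on the two side groups that agree on the edge group
have a common extension. -/
theorem exists_extension_of_isSeparatingEdge (T : TreeAction H V) {a b : V}
    (hab : T.graph.Adj a b) (hsep : T.IsSeparatingEdge a b) {K : Type*} [Group K]
    (ψa : T.sideGroup a b a →* K) (ψb : T.sideGroup a b b →* K)
    (hψ : ∀ (h : H) (ha : h ∈ T.sideGroup a b a) (hb : h ∈ T.sideGroup a b b),
      h ∈ edgeGroup H a b → ψa ⟨h, ha⟩ = ψb ⟨h, hb⟩) :
    ∃ φ : H →* K, (∀ h : T.sideGroup a b a, φ h = ψa h) ∧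
      ∀ h : T.sideGroup a b b, φ h = ψb h := by
  obtain ⟨ca, ca1, ca2, ca3, ca4⟩ := T.exists_cocycle a b a ψa
  obtain ⟨cb, cb1, cb2, cb3, cb4⟩ := T.exists_cocycle a b b ψb
  have disj : ∀ v, (¬ ∃ g : H, (T.cutForest a b).Reachable (g • a) v) ∨
      ¬ ∃ g : H, (T.cutForest a b).Reachable (g • b) v := by
    intro v
    by_contra! h
    obtain ⟨⟨g, hg⟩, ⟨g', hg'⟩⟩ := h
    have := T.cutForest_reachable_smul a b g⁻¹ (hg.trans hg'.symm)
    rw [inv_smul_smul, ← mul_smul] at this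
    exact hsep _ this
  have cba : ∀ h, cb h a = 1 := fun h => cb4 h a
    ((disj a).resolve_left (not_not.2 ⟨1, by rw [one_smul]⟩))
  have cab : ∀ h, ca h b = 1 := fun h => ca4 h b
    ((disj b).resolve_right (not_not.2 ⟨1, by rw [one_smul]⟩))
  have hcomm : ∀ (g h k : H) (v : V), cb g (k • v) * ca h v = ca h v * cb g (k • v) := by
    intro g h k v
    rcases disj v with hv | hv
    · rw [ca4 h v hv, one_mul, mul_one]
    · rw [cb4 g (k • v), one_mul, mul_one]
      rintro ⟨g', hg'⟩
      refine hv ⟨k⁻¹ * g', ?_⟩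
      have := T.cutForest_reachable_smul a b k⁻¹ hg'
      rwa [inv_smul_smul, ← mul_smul] at this
  obtain ⟨φ, p, hpa, hpb, hpF, hφ⟩ := T.exists_hom_of_cocycle hab
    (fun h v => ca h v * cb h v)
    (fun g h v => by
      rw [ca1, cb1]
      calc ca g (h • v) * ca h v * (cb g (h • v) * cb h v)
          = ca g (h • v) * (ca h v * cb g (h • v)) * cb h v := by group
        _ = _ := by rw [← hcomm]; group)
    (fun h u v huv => by rw [ca2 h u v huv, cb2 h u v huv]) 1 (by
      intro e he
      have he' := mem_edgeGroup.1 he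
      have hea : e ∈ T.sideGroup a b a := T.stabilizer_le_sideGroup a b a he'.1
      have heb : e ∈ T.sideGroup a b b := T.stabilizer_le_sideGroup a b b he'.2
      rw [cba, cab, mul_one, mul_one, one_mul, one_mul, ca3 ⟨e, hea⟩, cb3 ⟨e, heb⟩]
      exact hψ e hea heb he)
  refine ⟨φ, fun h => ?_, fun h => ?_⟩
  · rw [hφ _ a, ← hpF _ _ (mem_sideGroup.1 h.2), hpa, cba, ca3]
    simp
  · rw [hφ _ b, ← hpF _ _ (mem_sideGroup.1 h.2), hpb, cab, cb3]
    simp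

/-- For a nonseparating edge with trivial edge group, a homomorphism on the side group extends
with a prescribed value at a stable letter. -/
theorem exists_extension_of_reachable (T : TreeAction H V) {a b : V} (hab : T.graph.Adj a b)
    {t : H} (ht : (T.cutForest a b).Reachable a (t • b)) (hC : edgeGroup H a b = ⊥)
    {K : Type*} [Group K] (ψ : T.sideGroup a b a →* K) (k : K) :
    ∃ φ : H →* K, (∀ h : T.sideGroup a b a, φ h = ψ h) ∧ φ t = k := by
  obtain ⟨c, c1, c2, c3, -⟩ := T.exists_cocycle a b a ψ
  have c_one : ∀ v, c 1 v = 1 := by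
    intro v
    have := c1 1 1 v
    rw [one_smul, one_mul] at this
    exact left_eq_mul.1 this
  obtain ⟨φ, p, hpa, hpb, hpF, hφ⟩ := T.exists_hom_of_cocycle hab c c1 c2 (k⁻¹ * c t b) (by
    intro e he
    rw [hC, Subgroup.mem_bot] at he
    rw [he, c_one, c_one, one_mul, mul_one])
  refine ⟨φ, fun h => ?_, ?_⟩
  · rw [hφ _ a, ← hpF _ _ (mem_sideGroup.1 h.2), hpa, c3]
    simp
  · rw [hφ _ b, ← hpF _ _ ht, hpa, hpb]
    group

/-- Counting the translates of a nonseparating edge with sign is a nontrivial homomorphism to the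
integers; it is the coboundary of a function constant on the components of the forest. -/
theorem exists_hom_int_of_reachable (T : TreeAction H V) {a b : V} (hab : T.graph.Adj a b)
    {t : H} (ht : (T.cutForest a b).Reachable a (t • b)) :
    ∃ (φ : H →* Multiplicative ℤ) (p : V → Multiplicative ℤ), φ ≠ 1 ∧
      (∀ u v, (T.cutForest a b).Reachable u v → p u = p v) ∧
      ∀ h v, φ h = p (h • v) * (p v)⁻¹ := by
  obtain ⟨φ, p, hpa, hpb, hpF, hφ⟩ := T.exists_hom_of_cocycle hab
    (K := Multiplicative ℤ) (fun _ _ => 1) (by simp) (by simp) (Multiplicative.ofAdd 1) (by simp)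
  refine ⟨φ, p, ?_, hpF, fun h v => by simpa using hφ h v⟩
  intro h
  have h1 := hφ t b
  rw [h, ← hpF _ _ ht, hpa, hpb, MonoidHom.one_apply] at h1
  exact absurd h1 (by decide)

/-! ### Generation by side groups, and trivial edge groups -/

/-- A union of components of the forest that is closed under crossing translates of the edge
`{a, b}` contains all vertices. -/
theorem forall_mem_of_closed (T : TreeAction H V) {a b : V} (s : Set V)
    (hs : s.Nonempty) (hF : ∀ u v, (T.cutForest a b).Adj u v → u ∈ s → v ∈ s)
    (hab : ∀ g : H, g • a ∈ s ↔ g • b ∈ s) (v : V) : v ∈ s := by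
  obtain ⟨x, hx⟩ := hs
  have := (T.isTree.connected.preconnected x v).eq_of_forall_adj (f := fun v => v ∈ s) (by
    intro u v huv
    rcases T.cutForest_adj_or a b huv with h | ⟨g, rfl, rfl⟩ | ⟨g, rfl, rfl⟩
    · exact propext ⟨hF _ _ h, hF _ _ h.symm⟩
    · exact propext (hab g)
    · exact propext (hab g).symm)
  exact this ▸ hx

theorem reachable_smul_iff (T : TreeAction H V) (a b : V) (n : H) (u v : V) :
    (T.cutForest a b).Reachable (n • u) v ↔ (T.cutForest a b).Reachable u (n⁻¹ • v) := by
  refine ⟨fun h => ?_, fun h => ?_⟩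
  · simpa using T.cutForest_reachable_smul a b n⁻¹ h
  · simpa using T.cutForest_reachable_smul a b n h

theorem sideGroup_sup_sideGroup_eq_top (T : TreeAction H V) {a b : V}
    (hsep : T.IsSeparatingEdge a b) :
    T.sideGroup a b a ⊔ T.sideGroup a b b = ⊤ := by
  set N := T.sideGroup a b a ⊔ T.sideGroup a b b
  have hA : T.sideGroup a b a ≤ N := le_sup_left
  have hB : T.sideGroup a b b ≤ N := le_sup_right
  have key_a : ∀ n ∈ N, ∀ g : H, (T.cutForest a b).Reachable (n • a) (g • a) → g ∈ N := by
    intro n hn g h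
    rw [reachable_smul_iff, ← mul_smul] at h
    simpa using N.mul_mem hn (hA h)
  have key_b : ∀ n ∈ N, ∀ g : H, (T.cutForest a b).Reachable (n • b) (g • b) → g ∈ N := by
    intro n hn g h
    rw [reachable_smul_iff, ← mul_smul] at h
    simpa using N.mul_mem hn (hB h)
  have sep_ab : ∀ n g : H, ¬ (T.cutForest a b).Reachable (n • a) (g • b) := by
    intro n g h
    rw [reachable_smul_iff, ← mul_smul] at h
    exact hsep _ h
  let s : Set V := {v | ∃ n ∈ N, (T.cutForest a b).Reachable (n • a) v ∨
    (T.cutForest a b).Reachable (n • b) v}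
  have mem_a : ∀ g : H, g • a ∈ s → g ∈ N := by
    rintro g ⟨n, hn, h | h⟩
    · exact key_a n hn g h
    · exact absurd h.symm (sep_ab _ _)
  have mem_b : ∀ g : H, g • b ∈ s → g ∈ N := by
    rintro g ⟨n, hn, h | h⟩
    · exact absurd h (sep_ab _ _)
    · exact key_b n hn g h
  rw [eq_top_iff]
  intro g _
  refine mem_a g (T.forall_mem_of_closed (a := a) (b := b) s
    ⟨a, 1, N.one_mem, Or.inl (by rw [one_smul])⟩ ?_ ?_ _)
  · rintro u v huv ⟨n, hn, h⟩
    exact ⟨n, hn, h.imp (fun h => h.trans huv.reachable) (fun h => h.trans huv.reachable)⟩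
  · exact fun g => ⟨fun h => ⟨g, mem_a g h, Or.inr (SimpleGraph.Reachable.refl _)⟩,
      fun h => ⟨g, mem_b g h, Or.inl (SimpleGraph.Reachable.refl _)⟩⟩

theorem sideGroup_sup_zpowers_eq_top (T : TreeAction H V) {a b : V}
    {t : H} (ht : (T.cutForest a b).Reachable a (t • b)) :
    T.sideGroup a b a ⊔ Subgroup.zpowers t = ⊤ := by
  set N := T.sideGroup a b a ⊔ Subgroup.zpowers t
  have hA : T.sideGroup a b a ≤ N := le_sup_left
  have htN : t ∈ N := (le_sup_right : Subgroup.zpowers t ≤ N) (Subgroup.mem_zpowers t)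
  have key : ∀ n ∈ N, ∀ g : H, (T.cutForest a b).Reachable (n • a) (g • a) → g ∈ N := by
    intro n hn g h
    rw [reachable_smul_iff, ← mul_smul] at h
    simpa using N.mul_mem hn (hA h)
  have hb : ∀ g : H, (T.cutForest a b).Reachable ((g * t⁻¹) • a) (g • b) := by
    intro g
    simpa [mul_smul] using T.cutForest_reachable_smul a b (g * t⁻¹) ht
  rw [eq_top_iff]
  intro g _
  obtain ⟨n, hn, h⟩ := T.forall_mem_of_closed (a := a) (b := b)
    {v | ∃ n ∈ N, (T.cutForest a b).Reachable (n • a) v} ⟨a, 1, N.one_mem, by rw [one_smul]⟩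
    (by rintro u v huv ⟨n, hn, h⟩; exact ⟨n, hn, h.trans huv.reachable⟩)
    (fun g => ⟨fun ⟨n, hn, h⟩ => ⟨g * t⁻¹, N.mul_mem (key n hn g h) (N.inv_mem htN), hb g⟩,
      fun ⟨n, hn, h⟩ => ⟨g, by
        have := key n hn _ (h.trans (hb g).symm)
        simpa using N.mul_mem this htN, SimpleGraph.Reachable.refl _⟩⟩) (g • a)
  exact key n hn g h

theorem coprod_lift_bijective {A B : Subgroup H} (hAB : A ⊔ B = ⊤)
    (φ : H →* Monoid.Coprod A B) (hA : ∀ h : A, φ h = Monoid.Coprod.inl h)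
    (hB : ∀ h : B, φ h = Monoid.Coprod.inr h) :
    Function.Bijective (Monoid.Coprod.lift A.subtype B.subtype) := by
  constructor
  · have : φ.comp (Monoid.Coprod.lift A.subtype B.subtype) = MonoidHom.id _ :=
      Monoid.Coprod.hom_ext (MonoidHom.ext hA) (MonoidHom.ext hB)
    exact Function.LeftInverse.injective (g := φ) fun x => DFunLike.congr_fun this x
  · rw [← MonoidHom.range_eq_top, Monoid.Coprod.range_lift]
    simpa using hAB

/-- An edge with trivial stabilizer which separates exhibits `H` as the free product of the two
side groups. -/
theorem sideGroup_eq_bot_of_edgeGroup_eq_bot (T : TreeAction H V)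
    (hH : IsFreelyIndecomposable H) {a b : V} (hab : T.graph.Adj a b)
    (hC : edgeGroup H a b = ⊥) (hsep : T.IsSeparatingEdge a b) :
    T.sideGroup a b a = ⊥ ∨ T.sideGroup a b b = ⊥ := by
  obtain ⟨φ, hA, hB⟩ := T.exists_extension_of_isSeparatingEdge hab hsep
    (Monoid.Coprod.inl : _ →* Monoid.Coprod (T.sideGroup a b a) (T.sideGroup a b b))
    Monoid.Coprod.inr (by
      intro h ha hb hh
      rw [hC, Subgroup.mem_bot] at hh
      subst hh
      exact (map_one Monoid.Coprod.inl).trans (map_one Monoid.Coprod.inr).symm)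
  exact hH _ _ (coprod_lift_bijective (T.sideGroup_sup_sideGroup_eq_top hsep) φ hA hB)

/-- An edge with trivial stabilizer which does not separate exhibits `H` as the free product of
the side group and an infinite cyclic group. -/
theorem sideGroup_eq_bot_of_reachable (T : TreeAction H V)
    (hH : IsFreelyIndecomposable H) {a b : V} (hab : T.graph.Adj a b)
    (hC : edgeGroup H a b = ⊥) {t : H} (ht : (T.cutForest a b).Reachable a (t • b)) :
    T.sideGroup a b a = ⊥ := by
  obtain ⟨φ, hA, hB⟩ := T.exists_extension_of_reachable hab ht hC
    (Monoid.Coprod.inl : _ →* Monoid.Coprod (T.sideGroup a b a) (Subgroup.zpowers t))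
    (Monoid.Coprod.inr ⟨t, Subgroup.mem_zpowers t⟩)
  have hB' : ∀ h : Subgroup.zpowers t, φ h = Monoid.Coprod.inr h := by
    rintro ⟨_, k, rfl⟩
    change φ (t ^ k) = Monoid.Coprod.inr ((⟨t, Subgroup.mem_zpowers t⟩ : Subgroup.zpowers t) ^ k)
    rw [map_zpow, hB, map_zpow]
  refine (hH _ _ (coprod_lift_bijective (T.sideGroup_sup_zpowers_eq_top ht) φ hA hB')).resolve_right
    fun hz => ?_
  rw [Subgroup.zpowers_eq_bot] at hz
  subst hz
  obtain ⟨χ, -, hχt⟩ := T.exists_extension_of_reachable hab ht hC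
    (1 : _ →* Multiplicative ℤ) (Multiplicative.ofAdd 1)
  rw [map_one] at hχt
  exact absurd hχt (by decide)

end TreeAction

/-! ### Commuting elements of free groups -/

namespace IsFreeGroup

variable {E : Type*} [Group E] [IsFreeGroup E]

theorem isCyclic_of_subsingleton (h : Subsingleton (Generators E)) : IsCyclic E := by
  obtain ⟨u, hu⟩ : ∃ u : E, ∀ a : Generators E, of a = u := by
    rcases isEmpty_or_nonempty (Generators E) with h' | ⟨⟨a⟩⟩
    · exact ⟨1, fun a => h'.elim a⟩
    · exact ⟨of a, fun b => by rw [Subsingleton.elim b a]⟩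
  let f : E →* Subgroup.zpowers u := lift fun _ => ⟨u, Subgroup.mem_zpowers u⟩
  have hf : (Subgroup.zpowers u).subtype.comp f = MonoidHom.id E := by
    apply ext_hom
    intro a
    rw [MonoidHom.comp_apply, lift_of, MonoidHom.id_apply, hu]
    rfl
  refine ⟨u, fun x => ?_⟩
  have := DFunLike.congr_fun hf x
  rw [MonoidHom.id_apply] at this
  exact this ▸ (f x).2

theorem subsingleton_generators_of_comm (h : ∀ x y : E, x * y = y * x) :
    Subsingleton (Generators E) := by
  classical
  refine ⟨fun a b => by_contra fun hab => ?_⟩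
  let f : E →* Equiv.Perm (Fin 3) :=
    lift fun c => if c = a then Equiv.swap 0 1 else Equiv.swap 1 2
  have h1 := congrArg f (h (of a) (of b))
  simp only [map_mul, f, lift_of, if_true, if_neg (Ne.symm hab)] at h1
  exact absurd h1 (by decide)

/-- An abelian subgroup of a free group is cyclic: by Nielsen-Schreier it is free. -/
theorem exists_zpowers_eq_of_comm (S : Subgroup E) (h : ∀ x ∈ S, ∀ y ∈ S, x * y = y * x) :
    ∃ u ∈ S, Subgroup.zpowers u = S := by
  have h1 : IsCyclic S := isCyclic_of_subsingleton
    (subsingleton_generators_of_comm fun x y => Subtype.ext (h x x.2 y y.2))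
  obtain ⟨u, hu⟩ := (Subgroup.isCyclic_iff_exists_zpowers_eq_top S).1 h1
  exact ⟨u, hu ▸ Subgroup.mem_zpowers u, hu⟩

open Classical in
/-- The exponent sum of a generator. -/
noncomputable def exponentSum (a : Generators E) : E →* Multiplicative ℤ :=
  lift fun c => if c = a then Multiplicative.ofAdd 1 else 1

theorem exponentSum_self (a : Generators E) :
    exponentSum a (of a) = Multiplicative.ofAdd 1 := by
  simp [exponentSum]

theorem exponentSum_of_ne {a b : Generators E} (h : b ≠ a) : exponentSum a (of b) = 1 := by
  simp [exponentSum, h]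

/-- An element commuting with a generator is a power of it. -/
theorem mem_zpowers_of_commute {z : E} (a : Generators E) (h : z * of a = of a * z) :
    z ∈ Subgroup.zpowers (of a) := by
  have hcomm : ∀ x ∈ Subgroup.closure {z, of a}, ∀ y ∈ Subgroup.closure {z, of a},
      x * y = y * x := by
    intro x hx y hy
    have := Subgroup.isMulCommutative_closure (k := {z, of a}) (by
      rintro x (rfl | rfl) y (rfl | rfl) <;> first | rfl | exact h | exact h.symm)
    exact congrArg Subtype.val (mul_comm' (⟨x, hx⟩ : Subgroup.closure {z, of a}) ⟨y, hy⟩)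
  obtain ⟨u, -, hu⟩ := exists_zpowers_eq_of_comm _ hcomm
  obtain ⟨m, hm⟩ : z ∈ Subgroup.zpowers u := hu ▸ Subgroup.subset_closure (by simp)
  obtain ⟨n, hn⟩ : of a ∈ Subgroup.zpowers u := hu ▸ Subgroup.subset_closure (by simp)
  have h1 := congrArg (fun x => (exponentSum a x).toAdd) hn
  simp only [map_zpow, toAdd_zpow, exponentSum_self, smul_eq_mul, toAdd_ofAdd] at h1
  rw [← hm, ← hn]
  refine Subgroup.zpow_mem _ ?_ m
  rcases Int.eq_one_or_neg_one_of_mul_eq_one h1 with rfl | rfl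
  · simp
  · simp

/-- A free group with nontrivial center is abelian. -/
theorem comm_of_central {z : E} (hz : z ≠ 1) (h : ∀ x, z * x = x * z) (x y : E) :
    x * y = y * x := by
  have hs : Subsingleton (Generators E) := by
    refine ⟨fun a b => by_contra fun hab => hz ?_⟩
    obtain ⟨k, hk⟩ := mem_zpowers_of_commute a (h (of a))
    obtain ⟨l, hl⟩ := mem_zpowers_of_commute b (h (of b))
    have h1 := congrArg (fun x => (exponentSum a x).toAdd) (hk.trans hl.symm)
    simp only [map_zpow, toAdd_zpow, exponentSum_self, exponentSum_of_ne (Ne.symm hab),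
      smul_eq_mul, toAdd_ofAdd, mul_one, toAdd_one, mul_zero] at h1
    rw [← hk, h1]
    exact zpow_zero _
  have := isCyclic_of_subsingleton hs
  let _ := IsCyclic.commGroup (α := E)
  exact mul_comm x y

/-- Commutation is transitive on the nontrivial elements of a free group. -/
theorem commute_trans {x y z : E} (hx : x ≠ 1) (hy : x * y = y * x) (hz : x * z = z * x) :
    y * z = z * y := by
  let S := Subgroup.centralizer {x}
  have hS : ∀ {g : E}, x * g = g * x → g ∈ S := fun h =>
    Subgroup.mem_centralizer_singleton_iff.2 h.symm
  have := comm_of_central (E := S) (z := ⟨x, hS rfl⟩)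
    (fun h => hx (congrArg Subtype.val h))
    (fun g => Subtype.ext (Subgroup.mem_centralizer_singleton_iff.1 g.2).symm)
    ⟨y, hS hy⟩ ⟨z, hS hz⟩
  exact congrArg Subtype.val this

/-- In a free group an element commutes with `c ≠ 1` if it conjugates `c` to an element commuting
with `c`: it normalizes the cyclic centralizer of `c`, so its square centralizes it. -/
theorem commute_of_commute_conj [IsMulTorsionFree E] {c n : E} (hc : c ≠ 1)
    (h : c * (n * c * n⁻¹) = n * c * n⁻¹ * c) : n * c = c * n := by
  by_cases hn : n = 1
  · rw [hn, one_mul, mul_one]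
  have hc' : n * c * n⁻¹ ≠ 1 := by
    intro h1
    apply hc
    rwa [mul_inv_eq_one, mul_eq_left] at h1
  obtain ⟨u, hu, hS⟩ := exists_zpowers_eq_of_comm (Subgroup.centralizer {c}) (by
    intro x hx y hy
    rw [Subgroup.mem_centralizer_singleton_iff] at hx hy
    exact commute_trans hc hx.symm hy.symm)
  have mem_iff : ∀ g : E, g ∈ Subgroup.zpowers u ↔ c * g = g * c := by
    intro g
    rw [hS, Subgroup.mem_centralizer_singleton_iff, eq_comm]
  have huc := (mem_iff u).1 (Subgroup.mem_zpowers u)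
  have hu1 : u ≠ 1 := by
    rintro rfl
    have := (mem_iff c).2 rfl
    rw [Subgroup.zpowers_one_eq_bot, Subgroup.mem_bot] at this
    exact hc this
  have huc' : c * (n * u * n⁻¹) = n * u * n⁻¹ * c := by
    refine commute_trans hc' h.symm ?_
    calc n * c * n⁻¹ * (n * u * n⁻¹) = n * (c * u) * n⁻¹ := by group
      _ = n * (u * c) * n⁻¹ := by rw [huc]
      _ = _ := by group
  have hconj : c * (n⁻¹ * c * n) = n⁻¹ * c * n * c := by
    calc c * (n⁻¹ * c * n) = n⁻¹ * (n * c * n⁻¹ * c) * n := by group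
      _ = n⁻¹ * (c * (n * c * n⁻¹)) * n := by rw [h]
      _ = _ := by group
  have hc'' : n⁻¹ * c * n ≠ 1 := by
    intro h1
    apply hc
    calc c = n * (n⁻¹ * c * n) * n⁻¹ := by group
      _ = 1 := by rw [h1]; group
  have huc'' : c * (n⁻¹ * u * n) = n⁻¹ * u * n * c := by
    refine commute_trans hc'' hconj.symm ?_
    calc n⁻¹ * c * n * (n⁻¹ * u * n) = n⁻¹ * (c * u) * n := by group
      _ = n⁻¹ * (u * c) * n := by rw [huc]
      _ = _ := by group
  obtain ⟨k, hk⟩ := (mem_iff _).2 huc'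
  obtain ⟨l, hl⟩ := (mem_iff _).2 huc''
  simp only at hk hl
  have hkl : u ^ (k * l) = u ^ (1 : ℤ) := by
    calc u ^ (k * l) = (n * u * n⁻¹) ^ l := by rw [zpow_mul, hk]
      _ = n * u ^ l * n⁻¹ := by rw [conj_zpow]
      _ = u ^ (1 : ℤ) := by rw [hl, zpow_one]; group
  have hkl' : k * l = 1 := by
    rw [← mul_inv_eq_one, ← zpow_neg, ← zpow_add,
      IsMulTorsionFree.zpow_eq_one_iff_right hu1] at hkl
    omega
  have hk2 : k * k = 1 := by
    rcases Int.eq_one_or_neg_one_of_mul_eq_one hkl' with rfl | rfl <;> rfl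
  have hsq : n ^ 2 * u = u * n ^ 2 := by
    have : n * (n * u * n⁻¹) * n⁻¹ = u := by
      rw [← hk, ← conj_zpow, ← hk, ← zpow_mul, hk2, zpow_one]
    calc n ^ 2 * u = n * (n * u * n⁻¹) * n⁻¹ * n ^ 2 := by
          simp only [pow_two, mul_assoc, inv_mul_cancel_left, inv_mul_cancel, mul_one]
      _ = u * n ^ 2 := by rw [this]
  have hn2 : n ^ 2 ≠ 1 := fun h => hn ((pow_eq_one_iff_left (by norm_num)).1 h)
  have hnu : n * u = u * n := commute_trans hn2 (by group) hsq
  have hmc := (mem_iff c).2 rfl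
  obtain ⟨m, rfl⟩ := hmc
  exact (Commute.zpow_right (show Commute n u from hnu) m)

/-- A nonabelian free group has a nonzero homomorphism to the integers killing a given element:
two exponent sums are independent, and some combination vanishes at the element. -/
theorem exists_hom_int_ne_one {x y : E} (hxy : x * y ≠ y * x) (u : E) :
    ∃ ψ : E →* Multiplicative ℤ, ψ ≠ 1 ∧ ψ u = 1 := by
  obtain ⟨a, b, hab⟩ : ∃ a b : Generators E, a ≠ b := by
    by_contra! h
    have := isCyclic_of_subsingleton (E := E) ⟨h⟩
    let _ := IsCyclic.commGroup (α := E)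
    exact hxy (mul_comm x y)
  let p := (exponentSum a u).toAdd
  let q := (exponentSum b u).toAdd
  by_cases hp : exponentSum a u = 1
  · refine ⟨exponentSum a, fun h => ?_, hp⟩
    have h1 := exponentSum_self a
    rw [h, MonoidHom.one_apply] at h1
    exact absurd h1 (by decide)
  · refine ⟨exponentSum a ^ q * exponentSum b ^ (-p), fun h => hp ?_, ?_⟩
    · have h1 := congrArg Multiplicative.toAdd (DFunLike.congr_fun h (of b))
      simp [exponentSum_self, exponentSum_of_ne hab.symm] at h1
      exact h1
    · apply Multiplicative.toAdd.injective
      simp [p, q]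
      ring

end IsFreeGroup

/-! ### Limit groups -/

namespace IsLimitGroup

variable {G : Type*} [Group G]

theorem exists_hom_injOn (hG : IsLimitGroup G) (S : Finset G) :
    ∃ (n : ℕ) (f : G →* FreeGroup (Fin n)), Set.InjOn f (S : Set G) := hG.2 S

theorem commute_trans (hG : IsLimitGroup G) {x y z : G} (hx : x ≠ 1) (hy : x * y = y * x)
    (hz : x * z = z * x) : y * z = z * y := by
  classical
  obtain ⟨n, f, hf⟩ := hG.exists_hom_injOn {1, x, y * z, z * y}
  apply hf (by simp) (by simp)
  have hx' : f x ≠ 1 := fun h => hx (hf (by simp) (by simp) (h.trans (map_one f).symm))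
  rw [map_mul, map_mul]
  exact IsFreeGroup.commute_trans hx' (by rw [← map_mul, hy, map_mul])
    (by rw [← map_mul, hz, map_mul])

theorem commute_of_commute_conj (hG : IsLimitGroup G) {c n : G} (hc : c ≠ 1)
    (h : c * (n * c * n⁻¹) = n * c * n⁻¹ * c) : n * c = c * n := by
  classical
  obtain ⟨m, f, hf⟩ := hG.exists_hom_injOn {1, c, n * c, c * n}
  apply hf (by simp) (by simp)
  have hc' : f c ≠ 1 := fun h => hc (hf (by simp) (by simp) (h.trans (map_one f).symm))
  rw [map_mul, map_mul]
  refine IsFreeGroup.commute_of_commute_conj hc' ?_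
  simpa only [map_mul, map_inv] using congrArg f h

/-- A normal abelian subgroup of a nonabelian limit group is trivial. -/
theorem eq_bot_of_normal (hG : IsLimitGroup G) (hG' : ∃ x y : G, x * y ≠ y * x)
    (N : Subgroup G) [hN : N.Normal] (h : ¬ IsNonabelian N) : N = ⊥ := by
  rw [Subgroup.eq_bot_iff_forall]
  intro c hcN
  by_contra hc
  obtain ⟨x, y, hxy⟩ := hG'
  have key : ∀ n, c * n = n * c := by
    intro n
    refine (hG.commute_of_commute_conj hc ?_).symm
    by_contra hn
    exact h ⟨c, hcN, _, hN.conj_mem c hcN n, hn⟩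
  exact hxy (hG.commute_trans hc (key x) (key y))

/-- A nonabelian subgroup `B` of a limit group has a nonzero homomorphism to the integers killing
a given abelian subgroup: such exists on the image of `B` in a free group, where the
abelian subgroup becomes cyclic. -/
theorem exists_hom_int_of_isNonabelian (hG : IsLimitGroup G) {B C : Subgroup G}
    (hB : IsNonabelian B) (hCB : C ≤ B) (hC : ¬ IsNonabelian C) :
    ∃ ψ : B →* Multiplicative ℤ, ψ ≠ 1 ∧ ∀ c : B, (c : G) ∈ C → ψ c = 1 := by
  classical
  obtain ⟨x, hx, y, hy, hxy⟩ := hB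
  obtain ⟨n, f, hf⟩ := hG.exists_hom_injOn {x * y, y * x}
  have hxy' : f x * f y ≠ f y * f x := by
    rw [← map_mul, ← map_mul]
    exact fun h => hxy (hf (by simp) (by simp) h)
  obtain ⟨u, hu, hCu⟩ := IsFreeGroup.exists_zpowers_eq_of_comm (C.map f) (by
    rintro _ ⟨c, hc, rfl⟩ _ ⟨d, hd, rfl⟩
    rw [← map_mul, ← map_mul]
    congr 1
    by_contra hcd
    exact hC ⟨c, hc, d, hd, hcd⟩)
  have huB : u ∈ B.map f := Subgroup.map_mono hCB hu
  obtain ⟨ψ, hψ, hψu⟩ := IsFreeGroup.exists_hom_int_ne_one (E := B.map f)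
    (x := ⟨f x, x, hx, rfl⟩) (y := ⟨f y, y, hy, rfl⟩)
    (fun h => hxy' (congrArg Subtype.val h)) ⟨u, huB⟩
  refine ⟨ψ.comp (f.subgroupMap B), fun h => hψ ?_, fun c hc => ?_⟩
  · ext z
    obtain ⟨z, rfl⟩ := f.subgroupMap_surjective B z
    exact congrArg _ (DFunLike.congr_fun h z)
  · have : f c ∈ Subgroup.zpowers u := hCu ▸ Subgroup.mem_map_of_mem f hc
    obtain ⟨k, hk⟩ := this
    have h1 : f.subgroupMap B c = (⟨u, huB⟩ : B.map f) ^ k := Subtype.ext hk.symm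
    rw [MonoidHom.comp_apply, h1, map_zpow, hψu, one_zpow]

end IsLimitGroup

/-- An infinite finitely generated abelian group has a nonzero homomorphism to the
integers. -/
theorem exists_hom_int_ne_one_of_infinite (M : Type*) [Group M] [Group.FG M] [Infinite M]
    (hM : ∀ x y : M, x * y = y * x) : ∃ f : M →* Multiplicative ℤ, f ≠ 1 := by
  let _ : CommGroup M := { ‹Group M› with mul_comm := hM }
  obtain ⟨ι, j, hι, hj, p, hp, e, ⟨i⟩⟩ := CommGroup.equiv_free_prod_prod_multiplicative_zmod M
  have : Nonempty j := by
    by_contra hj'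
    rw [not_nonempty_iff] at hj'
    have : ∀ k, NeZero (p k ^ e k) := fun k => ⟨(pow_pos (hp k).pos _).ne'⟩
    have : ∀ k, Finite (Multiplicative (ZMod (p k ^ e k))) := fun k =>
      inferInstanceAs (Finite (ZMod (p k ^ e k)))
    exact not_finite_iff_infinite.2 ‹Infinite M› (Finite.of_equiv _ i.symm.toEquiv)
  obtain ⟨k⟩ := this
  refine ⟨((Pi.evalMonoidHom _ k).comp (MonoidHom.fst _ _)).comp i.toMonoidHom, fun h => ?_⟩
  have := DFunLike.congr_fun h (i.symm (fun _ => Multiplicative.ofAdd 1, 1))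
  simp at this

/-! ### Subgroups contained in a side group -/

namespace TreeAction

variable {G H : Type*} [Group G] [Group H] {V : Type*} [MulAction H V]

/-- If `η` is injective on `H¹`, then `G` is not contained in one side of a splitting of a limit
group `H` over an abelian group whose other side is large: otherwise a nonzero homomorphism
from `H` to the integers kills `G`. -/
theorem not_forall_mem_sideGroup (T : TreeAction H V) (hH : IsLimitGroup H) {η : G →* H}
    (hη : H1Injective η) {a b : V} (hab : T.graph.Adj a b)
    (hC : ¬ IsNonabelian (edgeGroup H a b))
    (hB : T.IsSeparatingEdge a b → IsNonabelian (T.sideGroup a b b) ∨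
      (edgeGroup H a b).relIndex (T.sideGroup a b b) = 0) :
    ¬ ∀ g, η g ∈ T.sideGroup a b a := by
  intro hL
  suffices h : ∃ φ : H →* Multiplicative ℤ, φ ≠ 1 ∧ ∀ h ∈ T.sideGroup a b a, φ h = 1 by
    obtain ⟨φ, hφ, hφA⟩ := h
    exact hφ (hη (MonoidHom.ext fun g => hφA _ (hL g)))
  by_cases hsep : T.IsSeparatingEdge a b
  swap
  · simp only [IsSeparatingEdge, not_forall, not_not] at hsep
    obtain ⟨t, ht⟩ := hsep
    obtain ⟨φ, p, hφ, hpF, hφp⟩ := T.exists_hom_int_of_reachable hab ht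
    refine ⟨φ, hφ, fun h hh => ?_⟩
    rw [hφp h a, ← hpF _ _ (mem_sideGroup.1 hh), mul_inv_cancel]
  by_cases hBn : IsNonabelian (T.sideGroup a b b)
  · obtain ⟨ψ, hψ, hψC⟩ := hH.exists_hom_int_of_isNonabelian hBn
      (inf_le_right.trans (T.stabilizer_le_sideGroup a b b)) hC
    obtain ⟨φ, hφA, hφB⟩ := T.exists_extension_of_isSeparatingEdge hab hsep 1 ψ
      fun h _ hb hh => (hψC ⟨h, hb⟩ hh).symm
    refine ⟨φ, fun h => hψ (MonoidHom.ext fun x => ?_), fun h hh => hφA ⟨h, hh⟩⟩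
    rw [← hφB, h, MonoidHom.one_apply, MonoidHom.one_apply]
  · have hcomm : ∀ x y : T.sideGroup a b b, x * y = y * x := by
      intro x y
      by_contra hxy
      exact hBn ⟨x, x.2, y, y.2, fun h => hxy (Subtype.ext h)⟩
    let C := (edgeGroup H a b).subgroupOf (T.sideGroup a b b)
    have hN : C.Normal := ⟨fun n hn g => by rwa [hcomm g n, mul_inv_cancel_right]⟩
    obtain ⟨φ, hφA, hφB⟩ := T.exists_extension_of_isSeparatingEdge hab hsep 1
      (QuotientGroup.mk' C) fun h _ hb hh =>
        ((QuotientGroup.eq_one_iff (N := C) ⟨h, hb⟩).2 hh).symm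
    have hsurj : Function.Surjective φ := by
      intro y
      obtain ⟨x, rfl⟩ := QuotientGroup.mk'_surjective C y
      exact ⟨x, hφB x⟩
    have : Group.FG H := hH.1
    have : Group.FG (T.sideGroup a b b ⧸ C) := Group.fg_of_surjective hsurj
    have : Infinite (T.sideGroup a b b ⧸ C) :=
      Subgroup.index_eq_zero_iff_infinite.1 ((hB hsep).resolve_left hBn)
    obtain ⟨χ, hχ⟩ := exists_hom_int_ne_one_of_infinite (T.sideGroup a b b ⧸ C) (by
      intro x y
      obtain ⟨x, rfl⟩ := QuotientGroup.mk'_surjective C x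
      obtain ⟨y, rfl⟩ := QuotientGroup.mk'_surjective C y
      rw [← map_mul, hcomm, map_mul])
    refine ⟨χ.comp φ, fun h => hχ (MonoidHom.ext fun x => ?_), fun h hh => ?_⟩
    · obtain ⟨y, rfl⟩ := hsurj x
      exact DFunLike.congr_fun h y
    · rw [MonoidHom.comp_apply, hφA ⟨h, hh⟩, MonoidHom.one_apply, map_one]

/-! ### Minimal invariant subtrees -/

/-- The action of `G` on an invariant set of vertices. -/
@[reducible]
def restrictAction (η : G →* H) (S : Set V) (hS : ∀ (g : G), ∀ v ∈ S, η g • v ∈ S) :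
    MulAction G S where
  smul g v := ⟨η g • (v : V), hS g v v.2⟩
  one_smul v := Subtype.ext (by change η 1 • (v : V) = v; rw [map_one, one_smul])
  mul_smul g h v := Subtype.ext (by
    change η (g * h) • (v : V) = η g • η h • (v : V); rw [map_mul, mul_smul])

/-- The edges of a minimal subtree have nontrivial stabilizers if `G` is nonabelian and freely
indecomposable: an edge with trivial stabilizer would give a free splitting of `G`, so it would
separate, with all of `G` stabilizing the component on one side, a smaller invariant subtree. -/
theorem IsMinimalSubtree.exists_ne_one {T : TreeAction H V} {η : G →* H} {S : Set V}
    (hS : T.IsMinimalSubtree η S) (hG : IsFreelyIndecomposable G)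
    (hG' : ∃ x y : G, x * y ≠ y * x) {u v : V} (hu : u ∈ S) (hv : v ∈ S)
    (huv : T.graph.Adj u v) : ∃ g : G, g ≠ 1 ∧ η g • u = u ∧ η g • v = v := by
  let _ : MulAction G S := restrictAction η S hS.1.2
  let X : TreeAction G S :=
    { graph := T.graph.induce S
      isTree := ⟨hS.1.1, T.isTree.isAcyclic.induce S⟩
      adj_smul := fun h {_ _} hxy => T.adj_smul (η h) hxy
      no_inversion := fun h {_ _} hxy hh =>
        T.no_inversion (η h) hxy ⟨congrArg Subtype.val hh.1, congrArg Subtype.val hh.2⟩ }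
  let a : S := ⟨u, hu⟩
  let b : S := ⟨v, hv⟩
  have hab : X.graph.Adj a b := huv
  by_contra! hne
  have hC : edgeGroup G a b = ⊥ := by
    rw [Subgroup.eq_bot_iff_forall]
    intro g hg
    rw [mem_edgeGroup] at hg
    by_contra hg1
    exact hne g hg1 (congrArg Subtype.val hg.1) (congrArg Subtype.val hg.2)
  have not_top : X.IsSeparatingEdge a b → ∀ x y : S, (x = a ∧ y = b ∨ x = b ∧ y = a) →
      X.sideGroup a b x ≠ ⊤ := by
    intro hsep x y hxy htop
    have hy : ¬ (X.cutForest a b).Reachable x y := by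
      intro h
      rcases hxy with ⟨hx, hy⟩ | ⟨hx, hy⟩ <;> rw [hx, hy] at h
      · exact hsep 1 (by rwa [one_smul])
      · exact hsep 1 (by rw [one_smul]; exact h.symm)
    let S' : Set V := {z | ∃ hz : z ∈ S, (X.cutForest a b).Reachable x ⟨z, hz⟩}
    have hx' : (x : V) ∈ S' := ⟨x.2, SimpleGraph.Reachable.refl _⟩
    have hconn : ∀ z z' : S, (X.cutForest a b).Walk z z' →
        ∀ (h : (z : V) ∈ S'), ∃ h' : (z' : V) ∈ S',
          (T.graph.induce S').Reachable ⟨z, h⟩ ⟨z', h'⟩ := by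
      intro z z' w
      induction w with
      | nil => exact fun h => ⟨h, SimpleGraph.Reachable.refl _⟩
      | @cons z y z' hzy _ ih =>
        intro h
        have hy' : (y : V) ∈ S' := ⟨y.2, h.2.trans hzy.reachable⟩
        obtain ⟨h', hr⟩ := ih hy'
        refine ⟨h', SimpleGraph.Reachable.trans (SimpleGraph.Adj.reachable ?_) hr⟩
        exact (SimpleGraph.deleteEdges_le _ hzy : X.graph.Adj z y)
    have hS' : T.IsInvariantSubtree η S' := by
      have : Nonempty S' := ⟨⟨x, hx'⟩⟩
      refine ⟨⟨?_⟩, ?_⟩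
      · have hbase : ∀ z : S', (T.graph.induce S').Reachable ⟨x, hx'⟩ z := by
          rintro ⟨z, hz, ⟨w⟩⟩
          exact (hconn _ _ w hx').2
        exact fun z z' => (hbase z).symm.trans (hbase z')
      · rintro g z ⟨hz, hr⟩
        refine ⟨hS.1.2 g z hz, ?_⟩
        have hg : g ∈ X.sideGroup a b x := htop ▸ Subgroup.mem_top g
        exact (mem_sideGroup.1 hg).trans (X.cutForest_reachable_smul a b g hr)
    have := hS.2 S' (fun z hz => hz.1) hS'
    have hyS : (y : V) ∈ S' := (Set.ext_iff.1 this y).2 y.2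
    exact hy hyS.2
  by_cases hsep : X.IsSeparatingEdge a b
  · have hgen := X.sideGroup_sup_sideGroup_eq_top hsep
    rcases X.sideGroup_eq_bot_of_edgeGroup_eq_bot hG hab hC hsep with h | h
    · rw [h, bot_sup_eq] at hgen
      exact not_top hsep b a (Or.inr ⟨rfl, rfl⟩) hgen
    · rw [h, sup_bot_eq] at hgen
      exact not_top hsep a b (Or.inl ⟨rfl, rfl⟩) hgen
  · simp only [IsSeparatingEdge, not_forall, not_not] at hsep
    obtain ⟨t, ht⟩ := hsep
    have hgen := X.sideGroup_sup_zpowers_eq_top ht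
    rw [X.sideGroup_eq_bot_of_reachable hG hab hC ht, bot_sup_eq] at hgen
    obtain ⟨x, y, hxy⟩ := hG'
    have hx : x ∈ Subgroup.zpowers t := hgen ▸ Subgroup.mem_top x
    have hy : y ∈ Subgroup.zpowers t := hgen ▸ Subgroup.mem_top y
    obtain ⟨m, rfl⟩ := hx
    obtain ⟨n, rfl⟩ := hy
    exact hxy ((Commute.refl t).zpow_zpow m n)

/-- A finitely generated group has a minimal invariant subtree: there is an invariant subtree
with finitely many orbits of vertices, and one with the least number of orbits is minimal. -/
theorem exists_isMinimalSubtree (T : TreeAction H V) (η : G →* H) (hG : Group.FG G) :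
    ∃ S, T.IsMinimalSubtree η S := by
  classical
  obtain ⟨x⟩ := T.isTree.connected.nonempty
  obtain ⟨E, hE⟩ := Group.fg_def.1 hG
  let w : ∀ g : G, T.graph.Walk x (η g • x) := fun g =>
    (T.isTree.connected.preconnected x (η g • x)).some
  let _ : MulAction G V := MulAction.compHom V η
  -- The translates of finitely many paths from `x` to its images under the generators.
  let F : Set V := {v | ∃ g ∈ E, v ∈ (w g).support} ∪ {x}
  have hF : F.Finite := by
    refine Set.Finite.union ?_ (Set.finite_singleton x)
    have : {v | ∃ g ∈ E, v ∈ (w g).support} = ⋃ g ∈ E, {v | v ∈ (w g).support} := by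
      ext v; simp
    rw [this]
    exact Set.Finite.biUnion E.finite_toSet fun g _ => List.finite_toSet _
  let S₀ : Set V := {v | ∃ g : G, ∃ f ∈ F, v = g • f}
  have hxF : x ∈ F := Or.inr rfl
  have hF₀ : ∀ (g : G), ∀ f ∈ F, g • f ∈ S₀ := fun g f hf => ⟨g, f, hf, rfl⟩
  have hinv : ∀ (g : G), ∀ v ∈ S₀, g • v ∈ S₀ := by
    rintro g _ ⟨h, f, hf, rfl⟩
    exact ⟨g * h, f, hf, (mul_smul _ _ _).symm⟩
  let R : S₀ → S₀ → Prop := (T.graph.induce S₀).Reachable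
  let x₀ : S₀ := ⟨x, 1, x, hxF, (one_smul G x).symm⟩
  have R_smul : ∀ (g : G) (u v : S₀), R u v →
      R ⟨g • (u : V), hinv g u u.2⟩ ⟨g • (v : V), hinv g v v.2⟩ := fun g u v h =>
    SimpleGraph.Reachable.map (G := T.graph.induce S₀) (G' := T.graph.induce S₀)
      ⟨fun u => ⟨g • (u : V), hinv g u u.2⟩, fun huv => T.adj_smul (η g) huv⟩ h
  have hpath : ∀ g (hg : g ∈ E) v (hv : v ∈ (w g).support),
      R x₀ ⟨v, by simpa using hF₀ 1 v (Or.inl ⟨g, hg, hv⟩)⟩ := by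
    intro g hg v hv
    have h1 := (w g).connected_induce_support.preconnected ⟨x, (w g).start_mem_support⟩ ⟨v, hv⟩
    exact h1.map (SimpleGraph.induceHomOfLE T.graph
      (fun z hz => by simpa using hF₀ 1 z (Or.inl ⟨g, hg, hz⟩))).toHom
  have hR : ∀ g : G, R x₀ ⟨g • x, hinv g x x₀.2⟩ := by
    intro g
    have hg : g ∈ Subgroup.closure (E : Set G) := hE ▸ Subgroup.mem_top g
    induction hg using Subgroup.closure_induction with
    | mem g hg => exact hpath g hg _ (w g).end_mem_support
    | one => simpa only [one_smul] using SimpleGraph.Reachable.refl x₀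
    | mul g h _ _ ihg ihh =>
      simpa only [← mul_smul] using SimpleGraph.Reachable.trans ihg (R_smul g _ _ ihh)
    | inv g _ ih =>
      simpa only [inv_smul_smul] using SimpleGraph.Reachable.symm (R_smul g⁻¹ _ _ ih)
  have hS₀ : T.IsInvariantSubtree η S₀ := by
    have : Nonempty S₀ := ⟨x₀⟩
    have hbase : ∀ v : S₀, R x₀ v := by
      rintro ⟨_, g, f, hf, rfl⟩
      refine (hR g).trans (R_smul g x₀ ⟨f, by simpa using hF₀ 1 f hf⟩ ?_)
      rcases hf with ⟨h, hh, hf⟩ | rfl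
      · exact hpath h hh f hf
      · exact SimpleGraph.Reachable.refl x₀
    exact ⟨⟨fun u v => (hbase u).symm.trans (hbase v)⟩, hinv⟩
  let π : V → MulAction.orbitRel.Quotient G V := Quotient.mk _
  have hfin : (π '' S₀).Finite := by
    refine (hF.image π).subset ?_
    rintro _ ⟨_, ⟨g, f, hf, rfl⟩, rfl⟩
    exact ⟨f, hf, Quotient.sound ⟨g⁻¹, inv_smul_smul g f⟩⟩
  obtain ⟨n, ⟨S, hSinv, hSfin, hSn⟩, hmin⟩ := Nat.findX
    (p := fun n => ∃ S, T.IsInvariantSubtree η S ∧ (π '' S).Finite ∧ (π '' S).ncard = n)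
    ⟨_, S₀, hS₀, hfin, rfl⟩
  refine ⟨S, hSinv, fun S' hS'S hS' => hS'S.antisymm fun v hv => ?_⟩
  have hsub : π '' S' ⊆ π '' S := Set.image_mono hS'S
  have heq : π '' S' = π '' S := by
    refine Set.eq_of_subset_of_ncard_le hsub ?_ hSfin
    by_contra! hlt
    exact hmin _ (hSn ▸ hlt) ⟨S', hS', hSfin.subset hsub, rfl⟩
  obtain ⟨v', hv', hvv'⟩ := heq.symm ▸ Set.mem_image_of_mem π hv
  obtain ⟨g, hg⟩ := Quotient.exact hvv'.symm
  exact hg ▸ hS'.2 g v' hv'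

end TreeAction

/-! ### Conjugation and centralizers of edge groups -/

section Conj

variable {H : Type*} [Group H]

theorem mem_conjSubgroup {g x : H} {K : Subgroup H} :
    x ∈ conjSubgroup g K ↔ g⁻¹ * x * g ∈ K := by
  constructor
  · rintro ⟨y, hy, rfl⟩
    simpa [mul_assoc] using hy
  · exact fun h => ⟨_, h, by simp [mul_assoc]⟩

theorem conjSubgroup_mul (g h : H) (K : Subgroup H) :
    conjSubgroup (g * h) K = conjSubgroup g (conjSubgroup h K) := by
  ext x
  simp only [mem_conjSubgroup, mul_inv_rev, mul_assoc]

theorem conjSubgroup_one (K : Subgroup H) : conjSubgroup 1 K = K := by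
  ext x
  simp [mem_conjSubgroup]

theorem IsNonabelian.mono {K L : Subgroup H} (hKL : K ≤ L) (hK : IsNonabelian K) :
    IsNonabelian L := by
  obtain ⟨x, hx, y, hy, hxy⟩ := hK
  exact ⟨x, hKL hx, y, hKL hy, hxy⟩

theorem IsNonabelian.conjSubgroup {K : Subgroup H} (hK : IsNonabelian K) (g : H) :
    IsNonabelian (conjSubgroup g K) := by
  obtain ⟨x, hx, y, hy, hxy⟩ := hK
  refine ⟨g * x * g⁻¹, ⟨x, hx, rfl⟩, g * y * g⁻¹, ⟨y, hy, rfl⟩, fun h => hxy ?_⟩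
  exact (MulAut.conj g).injective (by simpa only [map_mul, MulAut.conj_apply] using h)

variable {V : Type*} [MulAction H V]

theorem stabilizer_smul_eq_conjSubgroup (g : H) (v : V) :
    MulAction.stabilizer H (g • v) = conjSubgroup g (MulAction.stabilizer H v) :=
  MulAction.stabilizer_smul_eq_stabilizer_map_conj g v

theorem edgeGroup_smul (g : H) (u v : V) :
    edgeGroup H (g • u) (g • v) = conjSubgroup g (edgeGroup H u v) := by
  ext x
  simp only [mem_conjSubgroup, TreeAction.mem_edgeGroup, mul_smul, inv_smul_eq_iff]

end Conj

namespace TreeAction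

variable {G H : Type*} [Group G] [Group H] {V : Type*} [MulAction H V]

theorem mem_edgeCentralizer {T : TreeAction H V} {w u : V} {z : H} :
    z ∈ T.edgeCentralizer w u ↔ (∀ c ∈ edgeGroup H w u, c * z = z * c) ∧ z • w = w := by
  simp only [edgeCentralizer, Subgroup.mem_inf, Subgroup.mem_centralizer_iff, SetLike.mem_coe,
    MulAction.mem_stabilizer_iff]

theorem edgeCentralizer_smul (T : TreeAction H V) (g : H) (w u : V) :
    T.edgeCentralizer (g • w) (g • u) = conjSubgroup g (T.edgeCentralizer w u) := by
  ext z
  rw [mem_conjSubgroup, mem_edgeCentralizer, mem_edgeCentralizer]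
  refine and_congr ?_ ?_
  · rw [edgeGroup_smul]
    constructor
    · intro h c hc
      have := h (g * c * g⁻¹) ⟨c, hc, rfl⟩
      calc c * (g⁻¹ * z * g) = g⁻¹ * (g * c * g⁻¹ * z) * g := by group
        _ = g⁻¹ * (z * (g * c * g⁻¹)) * g := by rw [this]
        _ = _ := by group
    · rintro h _ ⟨c, hc, rfl⟩
      have := h c hc
      change g * c * g⁻¹ * z = z * (g * c * g⁻¹)
      calc g * c * g⁻¹ * z = g * (c * (g⁻¹ * z * g)) * g⁻¹ := by group
        _ = g * (g⁻¹ * z * g * c) * g⁻¹ := by rw [this]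
        _ = _ := by group
  · rw [mul_smul, mul_smul, inv_smul_eq_iff]

/-- In a limit group the centralizer of an abelian edge group is the centralizer of any of its
nontrivial elements. -/
theorem mem_edgeCentralizer_iff_commute {T : TreeAction H V} (hH : IsLimitGroup H)
    (hT : T.HasAbelianEdgeGroups) {w u : V} (hwu : T.graph.Adj w u) {c : H}
    (hc : c ∈ edgeGroup H w u) (hc1 : c ≠ 1) {z : H} :
    z ∈ T.edgeCentralizer w u ↔ c * z = z * c ∧ z • w = w := by
  rw [mem_edgeCentralizer]
  refine and_congr_left' ⟨fun h => h c hc, fun h d hd => hH.commute_trans hc1 ?_ h⟩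
  by_contra hcd
  exact hT w u hwu ⟨c, hc, d, hd, hcd⟩

theorem edgeCentralizer_eq_of_commute {T : TreeAction H V} (hH : IsLimitGroup H)
    (hT : T.HasAbelianEdgeGroups) {w u u' : V} (hwu : T.graph.Adj w u) (hwu' : T.graph.Adj w u')
    {c c' : H} (hc : c ∈ edgeGroup H w u) (hc1 : c ≠ 1) (hc' : c' ∈ edgeGroup H w u')
    (hc1' : c' ≠ 1) (hcc' : c * c' = c' * c) :
    T.edgeCentralizer w u' = T.edgeCentralizer w u := by
  ext z
  rw [mem_edgeCentralizer_iff_commute hH hT hwu hc hc1,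
    mem_edgeCentralizer_iff_commute hH hT hwu' hc' hc1']
  exact and_congr_left' ⟨fun h => hH.commute_trans hc1' hcc'.symm h,
    fun h => hH.commute_trans hc1 hcc' h⟩

/-! ### Blowing up the vertices of a tree -/

variable (H V) in
/-- A vertex of a tree together with a subgroup (in the applications, of the vertex group). -/
@[ext]
structure VertexSubgroup where
  /-- The underlying vertex. -/
  base : V
  /-- The subgroup. -/
  grp : Subgroup H

instance : MulAction H (VertexSubgroup H V) where
  smul g x := ⟨g • x.base, conjSubgroup g x.grp⟩
  one_smul x := VertexSubgroup.ext (one_smul H x.base) (conjSubgroup_one x.grp)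
  mul_smul g h x := VertexSubgroup.ext (mul_smul g h x.base) (conjSubgroup_mul g h x.grp)

theorem smul_vertexSubgroup_mk (g : H) (v : V) (K : Subgroup H) :
    g • (⟨v, K⟩ : VertexSubgroup H V) = ⟨g • v, conjSubgroup g K⟩ := rfl

/-- The vertex of the blow-up at which the edge `{v, u}` is attached on the side of `v`. -/
def attach (T : TreeAction H V) (v u : V) : VertexSubgroup H V :=
  ⟨v, T.edgeCentralizer v u⟩

theorem smul_attach (T : TreeAction H V) (g : H) (v u : V) :
    g • T.attach v u = T.attach (g • v) (g • u) := by
  rw [attach, attach, smul_vertexSubgroup_mk, edgeCentralizer_smul]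

/-- The underlying vertex of a vertex of the blow-up. -/
def blowUpBase : V ⊕ VertexSubgroup H V → V :=
  Sum.elim id VertexSubgroup.base

theorem blowUpBase_smul (g : H) (p : V ⊕ VertexSubgroup H V) :
    blowUpBase (g • p) = g • blowUpBase p := by
  cases p <;> rfl

/-- The graph of the blow-up: every vertex `v` becomes a star with leaves `(v, K)`, and an edge
`{v, u}` is attached to the leaf at `v` given by the centralizer of its edge group in the vertex
group of `v`, so that edges with the same centralizer are folded together near `v`. All subgroups
`K` are allowed, also those which do not occur as centralizers. -/
def blowUpGraph (T : TreeAction H V) : SimpleGraph (V ⊕ VertexSubgroup H V) where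
  Adj p q := (∃ u v, T.graph.Adj u v ∧ p = Sum.inr (T.attach u v) ∧ q = Sum.inr (T.attach v u)) ∨
    (∃ x : VertexSubgroup H V, p = Sum.inl x.base ∧ q = Sum.inr x) ∨
    ∃ x : VertexSubgroup H V, p = Sum.inr x ∧ q = Sum.inl x.base
  symm := ⟨by
    rintro p q (⟨u, v, huv, hp, hq⟩ | ⟨x, hp, hq⟩ | ⟨x, hp, hq⟩)
    · exact Or.inl ⟨v, u, huv.symm, hq, hp⟩
    · exact Or.inr (Or.inr ⟨x, hq, hp⟩)
    · exact Or.inr (Or.inl ⟨x, hq, hp⟩)⟩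
  loopless := ⟨by
    rintro p (⟨u, v, huv, hp, hq⟩ | ⟨x, hp, hq⟩ | ⟨x, hp, hq⟩)
    · rw [hp] at hq
      exact huv.ne (congrArg VertexSubgroup.base (Sum.inr_injective hq))
    · rw [hp] at hq
      cases hq
    · rw [hp] at hq
      cases hq⟩

theorem blowUpGraph_adj_attach (T : TreeAction H V) {u v : V} (huv : T.graph.Adj u v) :
    T.blowUpGraph.Adj (Sum.inr (T.attach u v)) (Sum.inr (T.attach v u)) :=
  Or.inl ⟨u, v, huv, rfl, rfl⟩

theorem blowUpGraph_adj_inl_inr (T : TreeAction H V) (x : VertexSubgroup H V) :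
    T.blowUpGraph.Adj (Sum.inl x.base) (Sum.inr x) :=
  Or.inr (Or.inl ⟨x, rfl, rfl⟩)

/-- The blow-up is a tree: collapsing the stars carries labellings of its edges to labellings of
the edges of the original tree, where they have potentials. -/
theorem blowUpGraph_isTree (T : TreeAction H V) : T.blowUpGraph.IsTree := by
  refine SimpleGraph.isTree_of_exists_potential ?_ fun l hl => ?_
  · have hbase : ∀ p : V ⊕ VertexSubgroup H V,
        T.blowUpGraph.Reachable (Sum.inl (blowUpBase p)) p := by
      rintro (v | x)
      · exact SimpleGraph.Reachable.refl _
      · exact (T.blowUpGraph_adj_inl_inr x).reachable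
    have hinl : ∀ u v : V, T.blowUpGraph.Reachable (Sum.inl u) (Sum.inl v) := by
      intro u v
      obtain ⟨w⟩ := T.isTree.connected.preconnected u v
      induction w with
      | nil => exact SimpleGraph.Reachable.refl _
      | cons h _ ih =>
        refine SimpleGraph.Reachable.trans ?_ ih
        exact (T.blowUpGraph_adj_inl_inr (T.attach _ _)).reachable.trans
          ((T.blowUpGraph_adj_attach h).reachable.trans
            (T.blowUpGraph_adj_inl_inr (T.attach _ _)).symm.reachable)
    have : Nonempty (V ⊕ VertexSubgroup H V) := T.isTree.connected.nonempty.map Sum.inl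
    exact ⟨fun p q => (hbase p).symm.trans ((hinl _ _).trans (hbase q))⟩
  · let j : VertexSubgroup H V → Multiplicative ℤ := fun x => l (Sum.inl x.base) (Sum.inr x)
    obtain ⟨p, hp⟩ := T.isTree.exists_potential
      (fun u v => j (T.attach u v) * l (Sum.inr (T.attach u v)) (Sum.inr (T.attach v u)) *
        (j (T.attach v u))⁻¹) (by
      intro u v huv
      simp only [hl _ _ (T.blowUpGraph_adj_attach huv)]
      group)
    refine ⟨Sum.elim p fun x => p x.base * j x, ?_⟩
    rintro _ _ (⟨u, v, huv, rfl, rfl⟩ | ⟨x, rfl, rfl⟩ | ⟨x, rfl, rfl⟩)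
    · change p v * j (T.attach v u) = p u * j (T.attach u v) * _
      rw [hp u v huv]
      group
    · rfl
    · change p x.base = p x.base * j x * _
      rw [hl _ _ (T.blowUpGraph_adj_inl_inr x)]
      exact (mul_inv_cancel_right _ _).symm

/-- The action on the blow-up. -/
def blowUp (T : TreeAction H V) : TreeAction H (V ⊕ VertexSubgroup H V) where
  graph := T.blowUpGraph
  isTree := T.blowUpGraph_isTree
  adj_smul := by
    rintro g _ _ (⟨u, v, huv, rfl, rfl⟩ | ⟨x, rfl, rfl⟩ | ⟨x, rfl, rfl⟩)
    · rw [Sum.smul_inr, Sum.smul_inr, smul_attach, smul_attach]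
      exact T.blowUpGraph_adj_attach (T.adj_smul g huv)
    · exact T.blowUpGraph_adj_inl_inr (g • x)
    · exact (T.blowUpGraph_adj_inl_inr (g • x)).symm
  no_inversion := by
    rintro g _ _ (⟨u, v, huv, rfl, rfl⟩ | ⟨x, rfl, rfl⟩ | ⟨x, rfl, rfl⟩) ⟨h1, h2⟩
    · refine T.no_inversion g huv ⟨?_, ?_⟩
      · exact (blowUpBase_smul g _).symm.trans (congrArg blowUpBase h1)
      · exact (blowUpBase_smul g _).symm.trans (congrArg blowUpBase h2)
    · cases h1
    · cases h1

theorem blowUp_cutForest_adj_attach (T : TreeAction H V) (x : VertexSubgroup H V) {u v : V}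
    (huv : T.graph.Adj u v) :
    (T.blowUp.cutForest (Sum.inl x.base) (Sum.inr x)).Adj
      (Sum.inr (T.attach u v)) (Sum.inr (T.attach v u)) := by
  rw [cutForest, SimpleGraph.deleteEdges_adj]
  refine ⟨T.blowUpGraph_adj_attach huv, ?_⟩
  rintro ⟨g, hg⟩
  rcases Sym2.eq_iff.1 hg with ⟨h, -⟩ | ⟨-, h⟩ <;> cases h

theorem blowUp_cutForest_adj_inl_inr (T : TreeAction H V) (x y : VertexSubgroup H V)
    (hxy : ¬ ∃ g : H, y = g • x) :
    (T.blowUp.cutForest (Sum.inl x.base) (Sum.inr x)).Adj (Sum.inl y.base) (Sum.inr y) := by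
  rw [cutForest, SimpleGraph.deleteEdges_adj]
  refine ⟨T.blowUpGraph_adj_inl_inr y, ?_⟩
  rintro ⟨g, hg⟩
  rcases Sym2.eq_iff.1 hg with ⟨-, h⟩ | ⟨h, -⟩
  · exact hxy ⟨g, Sum.inr_injective h⟩
  · cases h

/-- A subtree avoids the edge of the blow-up between `x` and its underlying vertex if at every
vertex where one of its edges is attached to a translate of `x`, all of them are. -/
theorem blowUp_reachable_attach (T : TreeAction H V) (x : VertexSubgroup H V) {S : Set V}
    (hS : (T.graph.induce S).Connected)
    (hx : ∀ v u u' : V, v ∈ S → u ∈ S → u' ∈ S → T.graph.Adj v u → T.graph.Adj v u' →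
      (∃ g : H, T.attach v u = g • x) → T.attach v u' = T.attach v u)
    {v u v' u' : V} (hv : v ∈ S) (hu : u ∈ S) (hv' : v' ∈ S) (hu' : u' ∈ S)
    (hvu : T.graph.Adj v u) (hvu' : T.graph.Adj v' u') :
    (T.blowUp.cutForest (Sum.inl x.base) (Sum.inr x)).Reachable
      (Sum.inr (T.attach v u)) (Sum.inr (T.attach v' u')) := by
  have turn : ∀ v u u' : V, v ∈ S → u ∈ S → u' ∈ S → T.graph.Adj v u → T.graph.Adj v u' →
      (T.blowUp.cutForest (Sum.inl x.base) (Sum.inr x)).Reachable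
        (Sum.inr (T.attach v u)) (Sum.inr (T.attach v u')) := by
    intro v u u' hv hu hu' hvu hvu'
    by_cases h : ∃ g : H, T.attach v u = g • x
    · rw [hx v u u' hv hu hu' hvu hvu' h]
    by_cases h' : ∃ g : H, T.attach v u' = g • x
    · rw [hx v u' u hv hu' hu hvu' hvu h']
    · exact (T.blowUp_cutForest_adj_inl_inr x _ h).symm.reachable.trans
        (T.blowUp_cutForest_adj_inl_inr x _ h').reachable
  have main : ∀ y z : S, (T.graph.induce S).Walk y z → ∀ u u' : V, u ∈ S → u' ∈ S →
      T.graph.Adj y u → T.graph.Adj z u' →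
      (T.blowUp.cutForest (Sum.inl x.base) (Sum.inr x)).Reachable
        (Sum.inr (T.attach y u)) (Sum.inr (T.attach z u')) := by
    intro y z w
    induction w with
    | @nil y => exact fun u u' hu hu' h h' => turn y u u' y.2 hu hu' h h'
    | @cons y y' z hyy' _ ih =>
      intro u u' hu hu' h h'
      have hyy'' : T.graph.Adj (y : V) (y' : V) := hyy'
      exact (turn y u y' y.2 hu y'.2 h hyy'').trans
        ((T.blowUp_cutForest_adj_attach x hyy'').reachable.trans
          (ih y u' y.2 hu' hyy''.symm h'))
  obtain ⟨w⟩ := hS.preconnected ⟨v, hv⟩ ⟨v', hv'⟩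
  exact main _ _ w u u' hu hu' hvu hvu'

/-- The edge of the blow-up at the centralizer of a nontrivial edge group has an abelian group:
this group normalizes the centralizer, which is malnormal in the vertex group. -/
theorem not_isNonabelian_edgeGroup_blowUp {T : TreeAction H V} (hH : IsLimitGroup H)
    (hT : T.HasAbelianEdgeGroups) {w u : V} (hwu : T.graph.Adj w u)
    (hC : edgeGroup H w u ≠ ⊥) :
    ¬ IsNonabelian (edgeGroup H (Sum.inl w : V ⊕ VertexSubgroup H V)
      (Sum.inr (T.attach w u))) := by
  obtain ⟨⟨c, hc⟩, hne⟩ := Subgroup.ne_bot_iff_exists_ne_one.1 hC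
  have hc1 : c ≠ 1 := fun h => hne (Subtype.ext h)
  have key : ∀ n ∈ edgeGroup H (Sum.inl w : V ⊕ VertexSubgroup H V) (Sum.inr (T.attach w u)),
      c * n = n * c := by
    intro n hn
    rw [mem_edgeGroup] at hn
    have hcZ : c ∈ T.edgeCentralizer w u :=
      (mem_edgeCentralizer_iff_commute hH hT hwu hc hc1).2 ⟨rfl, (mem_edgeGroup.1 hc).1⟩
    have hnZ : conjSubgroup n (T.edgeCentralizer w u) = T.edgeCentralizer w u :=
      congrArg VertexSubgroup.grp (Sum.inr_injective hn.2)
    have hncn : n * c * n⁻¹ ∈ T.edgeCentralizer w u := hnZ ▸ ⟨c, hcZ, rfl⟩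
    exact (hH.commute_of_commute_conj hc1
      ((mem_edgeCentralizer_iff_commute hH hT hwu hc hc1).1 hncn).1).symm
  rintro ⟨x, hx, y, hy, hxy⟩
  exact hxy (hH.commute_trans hc1 (key x hx) (key y hy))

end TreeAction

/-! ### Maps between limit groups that are injective on first cohomology -/

theorem SimpleGraph.Reachable.exists_adj_of_ne {V : Type*} {X : SimpleGraph V} {u v : V}
    (h : X.Reachable u v) (huv : u ≠ v) : ∃ w, X.Adj u w := by
  obtain ⟨_ | ⟨h, _⟩⟩ := h
  · exact absurd rfl huv
  · exact ⟨_, h⟩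

section Injectivity

variable {G H : Type*} [Group G] [Group H]

/-- If `η` is injective on `H¹` and the limit group `H` is nonabelian, so is `G`. -/
theorem H1Injective.exists_not_commute {η : G →* H} (hη : H1Injective η) (hH : IsLimitGroup H)
    {K : Subgroup H} (hK : IsNonabelian K) : ∃ x y : G, x * y ≠ y * x := by
  by_contra! hG
  obtain ⟨ψ, hψ, hψη⟩ := hH.exists_hom_int_of_isNonabelian (hK.mono le_top)
    (le_top : η.range ≤ ⊤) (by
      rintro ⟨_, ⟨x, rfl⟩, _, ⟨y, rfl⟩, hxy⟩
      exact hxy (by rw [← map_mul, hG, map_mul]))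
  have : ψ.comp Subgroup.topEquiv.symm.toMonoidHom = 1 :=
    hη (MonoidHom.ext fun g => hψη ⟨η g, trivial⟩ ⟨g, rfl⟩)
  exact hψ (MonoidHom.ext fun x => DFunLike.congr_fun this (x : H))

/-- A homomorphism from a nonabelian limit group is injective if the preimage of some subgroup
is abelian, since this preimage contains the kernel. -/
theorem IsLimitGroup.injective_of_not_isNonabelian_comap (hG : IsLimitGroup G)
    (hG' : ∃ x y : G, x * y ≠ y * x) {η : G →* H} {K : Subgroup H}
    (hK : ¬ IsNonabelian (K.comap η)) : Function.Injective η := by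
  rw [← MonoidHom.ker_eq_bot_iff]
  exact hG.eq_bot_of_normal hG' _ fun h => hK (h.mono (Subgroup.comap_mono bot_le))

end Injectivity

namespace TreeAction

variable {G H : Type*} [Group G] [Group H] {V : Type*} [MulAction H V]

/-- The edges of a minimal subtree starting at a vertex with abelian stabilizer in `G` are all
attached to the same vertex of the blow-up: their stabilizers in `G` are nontrivial, because `G`
is freely indecomposable, and commute. -/
theorem IsMinimalSubtree.attach_eq {T : TreeAction H V} {η : G →* H} {S : Set V}
    (hS : T.IsMinimalSubtree η S) (hT : T.HasAbelianEdgeGroups) (hG : IsLimitGroup G)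
    (hGi : IsFreelyIndecomposable G) (hG' : ∃ x y : G, x * y ≠ y * x) (hH : IsLimitGroup H)
    {v u u' : V} (hv : v ∈ S) (hu : u ∈ S) (hu' : u' ∈ S) (hvu : T.graph.Adj v u)
    (hvu' : T.graph.Adj v u') (hab : ¬ IsNonabelian (T.inducedVertexGroup η v)) :
    T.attach v u' = T.attach v u := by
  have hinj : Function.Injective η := hG.injective_of_not_isNonabelian_comap hG' hab
  have hne : ∀ g : G, g ≠ 1 → η g ≠ 1 := fun g hg h => hg (hinj (h.trans (map_one η).symm))
  obtain ⟨g, hg1, hgv, hgu⟩ := hS.exists_ne_one hGi hG' hv hu hvu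
  obtain ⟨g', hg1', hgv', hgu'⟩ := hS.exists_ne_one hGi hG' hv hu' hvu'
  rw [attach, edgeCentralizer_eq_of_commute hH hT hvu hvu' (mem_edgeGroup.2 ⟨hgv, hgu⟩)
    (hne g hg1) (mem_edgeGroup.2 ⟨hgv', hgu'⟩) (hne g' hg1') ?_, attach]
  rw [← map_mul, ← map_mul]
  by_contra h
  exact hab ⟨g, hgv, g', hgv', fun h' => h (congrArg η h')⟩

theorem IsInvariantSubtree.exists_adj {T : TreeAction H V} {η : G →* H} {S : Set V}
    (hS : T.IsInvariantSubtree η S) {w : V} (hw : w ∈ S) :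
    (∀ g, η g • w = w) ∨ ∃ u ∈ S, T.graph.Adj w u := by
  by_cases h : ∀ g, η g • w = w
  · exact Or.inl h
  · push Not at h
    obtain ⟨g, hg⟩ := h
    obtain ⟨u, hu⟩ := (hS.1.preconnected ⟨w, hw⟩ ⟨η g • w, hS.2 g w hw⟩).exists_adj_of_ne
      (fun h => hg (congrArg Subtype.val h).symm)
    exact Or.inr ⟨u, u.2, hu⟩

theorem isHyperbolic_of_isEssential (T : TreeAction H V) (hH : IsLimitGroup H) {η : G →* H}
    (hη : H1Injective η) (hT : T.IsEssentialOneEdgedAbelianSplitting) : T.IsHyperbolic η := by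
  rintro ⟨v, hv⟩
  obtain ⟨⟨⟨x, y, hxy⟩, -⟩, hab, hess⟩ := hT
  obtain ⟨u, hvu⟩ : ∃ u, T.graph.Adj v u := by
    by_cases hvx : v = x
    · exact ⟨y, hvx ▸ hxy⟩
    · exact (T.isTree.connected.preconnected v x).exists_adj_of_ne hvx
  exact T.not_forall_mem_sideGroup hH hη hvu (hab v u hvu)
    (fun hsep => Or.inr ((hess v u hvu).2.2 hsep).2)
    fun g => T.stabilizer_le_sideGroup v u v (hv g)

/-- If an invariant subtree contains no translate of `v`, then `G` lies in one side of the
splitting carried by the edge at a translate of `v` which leads towards the subtree. -/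
theorem exists_forall_mem_sideGroup_of_disjoint (T : TreeAction H V) {η : G →* H} {S : Set V}
    (hS : T.IsInvariantSubtree η S) {v : V} (hv : ∀ h : H, h • v ∉ S) :
    ∃ (h : H) (u : V), T.graph.Adj u (h • v) ∧ ∀ g, η g ∈ T.sideGroup u (h • v) u := by
  obtain ⟨⟨s, hs⟩⟩ := hS.1.nonempty
  -- The forest obtained by deleting all edges that meet the orbit of `v`.
  let F := T.graph.deleteEdges {e | ∃ h : H, h • v ∈ e}
  have F_adj : ∀ x y, T.graph.Adj x y → (∀ h : H, h • v ≠ x) → (∀ h : H, h • v ≠ y) →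
      F.Adj x y := by
    intro x y hxy hx hy
    rw [SimpleGraph.deleteEdges_adj]
    refine ⟨hxy, ?_⟩
    rintro ⟨h, hh⟩
    rcases Sym2.mem_iff.1 hh with hh | hh
    · exact hx h hh
    · exact hy h hh
  have F_S : ∀ z ∈ S, F.Reachable s z := by
    intro z hz
    have h := hS.1.preconnected ⟨s, hs⟩ ⟨z, hz⟩
    exact h.map (G' := F) ⟨Subtype.val, fun {a b} hab =>
      F_adj a b hab (fun h hh => hv h (hh ▸ a.2)) fun h hh => hv h (hh ▸ b.2)⟩
  have main : ∀ x y, T.graph.Walk x y → F.Reachable s y → (∀ h : H, h • v ≠ y) →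
      ((∀ h : H, h • v ≠ x) ∧ F.Reachable s x) ∨
        ∃ (h : H) (u : V), T.graph.Adj u (h • v) ∧ F.Reachable s u := by
    intro x y w hy hy'
    induction w with
    | nil => exact Or.inl ⟨hy', hy⟩
    | @cons x x' y hxx' _ ih =>
      rcases ih hy hy' with ⟨h1, h2⟩ | h
      · by_cases hx : ∃ h : H, h • v = x
        · obtain ⟨h, rfl⟩ := hx
          exact Or.inr ⟨h, x', hxx'.symm, h2⟩
        · push Not at hx
          exact Or.inl ⟨hx, h2.trans (F_adj _ _ hxx' hx h1).symm.reachable⟩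
      · exact Or.inr h
  obtain ⟨w⟩ := T.isTree.connected.preconnected v s
  obtain ⟨h, -⟩ | ⟨h, u, huv, hu⟩ := main v s w (SimpleGraph.Reachable.refl _)
    fun h hh => hv h (hh ▸ hs)
  · exact absurd (one_smul H v) (h 1)
  · refine ⟨h, u, huv, fun g => ?_⟩
    have hF : F ≤ T.cutForest u (h • v) := by
      refine SimpleGraph.deleteEdges_anti ?_
      rintro _ ⟨k, rfl⟩
      exact ⟨k * h, by rw [mul_smul]; exact Sym2.mem_mk_right _ _⟩
    have hsu := hu.mono hF
    exact hsu.symm.trans (((F_S _ (hS.2 g s hs)).mono hF).trans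
      (T.cutForest_reachable_smul u (h • v) (η g) hsu))

/-- If all stabilizers in `G` of translates of `v` were abelian, then `G` would lie in one side of
a splitting of `H` whose other side contains the nonabelian vertex group of a translate
of `v`. -/
theorem exists_isNonabelian_comap (T : TreeAction H V) (hT : T.HasAbelianEdgeGroups)
    (hG : IsLimitGroup G) (hGi : IsFreelyIndecomposable G) (hH : IsLimitGroup H) {η : G →* H}
    (hη : H1Injective η) {v : V} (hv : IsNonabelian (MulAction.stabilizer H v)) :
    ∃ h : H, IsNonabelian ((conjSubgroup h (MulAction.stabilizer H v)).comap η) := by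
  by_contra! hab
  have hab' : ∀ h : H, ¬ IsNonabelian (T.inducedVertexGroup η (h • v)) := by
    intro h
    rw [inducedVertexGroup, stabilizer_smul_eq_conjSubgroup]
    exact hab h
  have hG' := hη.exists_not_commute hH hv
  have hnon : ∀ h : H, IsNonabelian (MulAction.stabilizer H (h • v)) := fun h => by
    rw [stabilizer_smul_eq_conjSubgroup]
    exact hv.conjSubgroup h
  obtain ⟨S, hS⟩ := T.exists_isMinimalSubtree η hG.1
  by_cases hvS : ∃ h : H, h • v ∈ S
  · obtain ⟨h, hw⟩ := hvS
    set w := h • v with hwv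
    obtain hfix | ⟨u, hu, hwu⟩ := hS.1.exists_adj hw
    · obtain ⟨x, y, hxy⟩ := hG'
      exact hab' h ⟨x, hfix x, y, hfix y, hxy⟩
    obtain ⟨g, hg1, hgw, hgu⟩ := hS.exists_ne_one hGi hG' hw hu hwu
    have hinj := hG.injective_of_not_isNonabelian_comap hG' (hab 1)
    have hC : edgeGroup H w u ≠ ⊥ := by
      intro h
      have : η g ∈ edgeGroup H w u := mem_edgeGroup.2 ⟨hgw, hgu⟩
      rw [h, Subgroup.mem_bot] at this
      exact hg1 (hinj (this.trans (map_one η).symm))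
    refine T.blowUp.not_forall_mem_sideGroup hH hη
      (T.blowUpGraph_adj_inl_inr (T.attach w u)).symm ?_ (fun _ => Or.inl ?_) fun g => ?_
    · rw [edgeGroup_comm]
      exact not_isNonabelian_edgeGroup_blowUp hH hT hwu hC
    · refine (hnon h).mono (le_trans ?_ (T.blowUp.stabilizer_le_sideGroup _ _ _))
      exact fun k hk => congrArg Sum.inl hk
    · rw [mem_sideGroup, cutForest_comm, Sum.smul_inr, smul_attach]
      refine T.blowUp_reachable_attach (T.attach w u) hS.1.1 ?_ hw hu (hS.1.2 g w hw)
        (hS.1.2 g u hu) hwu (T.adj_smul _ hwu)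
      rintro x y y' hx hy hy' hxy hxy' ⟨k, hk⟩
      refine hS.attach_eq hT hG hGi hG' hH hx hy hy' hxy hxy' ?_
      have : x = (k * h) • v := by
        rw [mul_smul]
        exact congrArg VertexSubgroup.base hk
      rw [this]
      exact hab' _
  · push Not at hvS
    obtain ⟨h, u, hu, hL⟩ := T.exists_forall_mem_sideGroup_of_disjoint hS.1 hvS
    exact T.not_forall_mem_sideGroup hH hη hu (hT _ _ hu)
      (fun _ => Or.inl ((hnon h).mono (T.stabilizer_le_sideGroup _ _ _))) hL

/-- A freely indecomposable group has no essential edge with trivial edge group. -/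
theorem IsEssentialEdge.edgeGroup_ne_bot {T : TreeAction H V} {a b : V}
    (h : T.IsEssentialEdge a b) (hab : T.graph.Adj a b) (hH : IsFreelyIndecomposable H) :
    edgeGroup H a b ≠ ⊥ := by
  intro hC
  by_cases hsep : T.IsSeparatingEdge a b
  · rcases T.sideGroup_eq_bot_of_edgeGroup_eq_bot hH hab hC hsep with h' | h'
    · exact h.1 (h' ▸ inferInstance)
    · exact h.2.1 (h' ▸ inferInstance)
  · simp only [IsSeparatingEdge, not_forall, not_not] at hsep
    obtain ⟨t, ht⟩ := hsep
    exact h.1 (T.sideGroup_eq_bot_of_reachable hH hab hC ht ▸ inferInstance)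

/-- The stabilizer of an edge of the blow-up has infinite index in the side of the leaf, if this
already holds for the corresponding edge of the original tree. -/
theorem blowUp_relIndex_sideGroup_eq_zero (T : TreeAction H V) {w u : V}
    (hwu : T.graph.Adj w u) (hsep : T.IsSeparatingEdge w u)
    (h : (edgeGroup H w u).relIndex (T.sideGroup w u u) = 0) :
    (edgeGroup H (Sum.inl w : V ⊕ VertexSubgroup H V) (Sum.inr (T.attach w u))).relIndex
      (T.blowUp.sideGroup (Sum.inl w) (Sum.inr (T.attach w u)) (Sum.inr (T.attach w u))) = 0 := by
  have not_orbit : ∀ x, (T.cutForest w u).Reachable u x → ∀ g : H, x ≠ g • w := by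
    rintro x hx g rfl
    exact T.isSeparatingEdge_comm hsep g (by rwa [cutForest_comm])
  have not_attach : ∀ x y, (T.cutForest w u).Reachable u x →
      ¬ ∃ g : H, T.attach x y = g • T.attach w u :=
    fun x y hx ⟨g, hg⟩ => not_orbit x hx g (congrArg VertexSubgroup.base hg)
  have hwalk : ∀ x y, (T.cutForest w u).Walk x y → (T.cutForest w u).Reachable u x →
      (T.blowUp.cutForest (Sum.inl w) (Sum.inr (T.attach w u))).Reachable
        (Sum.inl x) (Sum.inl y) := by
    intro x y p
    induction p with
    | nil => exact fun _ => SimpleGraph.Reachable.refl _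
    | @cons x x' y hxx' _ ih =>
      intro hx
      have hx' := hx.trans hxx'.reachable
      exact (T.blowUp_cutForest_adj_inl_inr (T.attach w u) (T.attach x x')
        (not_attach _ _ hx)).reachable.trans ((T.blowUp_cutForest_adj_attach (T.attach w u)
          (SimpleGraph.deleteEdges_le _ hxx')).reachable.trans
        ((T.blowUp_cutForest_adj_inl_inr (T.attach w u) (T.attach x' x)
          (not_attach _ _ hx')).symm.reachable.trans (ih hx')))
  have hu : (T.blowUp.cutForest (Sum.inl w) (Sum.inr (T.attach w u))).Reachable
      (Sum.inr (T.attach w u)) (Sum.inl u) :=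
    (T.blowUp_cutForest_adj_attach (T.attach w u) hwu).reachable.trans
      (T.blowUp_cutForest_adj_inl_inr (T.attach w u) (T.attach u w)
        (not_attach _ _ (SimpleGraph.Reachable.refl _))).symm.reachable
  refine Subgroup.relIndex_eq_zero_of_le_right (K := T.sideGroup w u u) ?_ ?_
  · intro g hg
    obtain ⟨p⟩ := mem_sideGroup.1 hg
    exact hu.trans ((hwalk _ _ p (SimpleGraph.Reachable.refl _)).trans
      (T.blowUp.cutForest_reachable_smul _ _ g hu).symm)
  · rw [← Subgroup.inf_relIndex_right]
    refine Subgroup.relIndex_eq_zero_of_le_left ?_ h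
    rintro g ⟨hg, hgu⟩
    have hgw : g • w = w := Sum.inl_injective (mem_edgeGroup.1 hg).1
    refine mem_edgeGroup.2 ⟨hgw, ?_⟩
    by_contra hne
    -- Otherwise `u` and `g • u` are joined both through `w` and in the forest.
    refine SimpleGraph.isBridge_iff.1
      (SimpleGraph.isAcyclic_iff_forall_adj_isBridge.1 T.isTree.isAcyclic hwu) ?_
    have h1 : (T.graph.deleteEdges {s(w, u)}).Adj w (g • u) := by
      rw [SimpleGraph.deleteEdges_adj]
      refine ⟨by simpa [hgw] using T.adj_smul g hwu, fun h => ?_⟩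
      rcases Sym2.eq_iff.1 h with ⟨-, h⟩ | ⟨h, -⟩
      · exact hne h
      · exact hwu.ne h
    refine h1.reachable.trans (SimpleGraph.Reachable.mono ?_ (mem_sideGroup.1 hgu).symm)
    refine SimpleGraph.deleteEdges_anti ?_
    rintro _ rfl
    exact ⟨1, by rw [one_smul, one_smul]⟩

/-- If an edge `{w, u}` does not separate, but the corresponding edge of the blow-up does, then
counting translates of `{w, u}` with sign kills the side of `w`. -/
theorem exists_hom_int_of_blowUp_isSeparatingEdge (T : TreeAction H V) {w u : V}
    (hwu : T.graph.Adj w u) (hsep : ¬ T.IsSeparatingEdge w u)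
    (hsep' : T.blowUp.IsSeparatingEdge (Sum.inl w) (Sum.inr (T.attach w u))) :
    ∃ φ : H →* Multiplicative ℤ, φ ≠ 1 ∧
      ∀ h ∈ T.blowUp.sideGroup (Sum.inl w) (Sum.inr (T.attach w u)) (Sum.inl w), φ h = 1 := by
  simp only [IsSeparatingEdge, not_forall, not_not] at hsep
  obtain ⟨t, ht⟩ := hsep
  obtain ⟨φ, p, hφ, hpF, hφp⟩ := T.exists_hom_int_of_reachable hwu ht
  refine ⟨φ, hφ, fun h hh => ?_⟩
  let F := T.blowUp.cutForest (Sum.inl w) (Sum.inr (T.attach w u))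
  -- The translates of `{w, u}` are attached on the other side.
  have hedge : ∀ x y, T.graph.Adj x y → F.Reachable (Sum.inl w) (Sum.inr (T.attach x y)) →
      p x = p y := by
    intro x y hxy hx
    rcases T.cutForest_adj_or w u hxy with hF | ⟨g, rfl, rfl⟩ | ⟨g, rfl, rfl⟩
    · exact hpF _ _ hF.reachable
    · refine absurd hx ?_
      rw [← smul_attach]
      exact hsep' g
    · refine absurd (hx.trans (T.blowUp_cutForest_adj_attach (T.attach w u) hxy).reachable) ?_
      rw [← smul_attach]
      exact hsep' g
  have hwalk : ∀ q r, F.Walk q r → F.Reachable (Sum.inl w) q →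
      p (blowUpBase q) = p (blowUpBase r) := by
    intro q r c
    induction c with
    | nil => exact fun _ => rfl
    | @cons q q' r hqq' _ ih =>
      intro hq
      refine Eq.trans ?_ (ih (hq.trans hqq'.reachable))
      have hadj : T.blowUpGraph.Adj q q' := SimpleGraph.deleteEdges_le _ hqq'
      rcases hadj with ⟨x, y, hxy, rfl, rfl⟩ | ⟨x, rfl, rfl⟩ | ⟨x, rfl, rfl⟩
      · exact hedge x y hxy hq
      · rfl
      · rfl
  obtain ⟨c⟩ := mem_sideGroup.1 hh
  rw [hφp h w, mul_inv_eq_one]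
  exact (hwalk _ _ c (SimpleGraph.Reachable.refl _)).symm

/-- If no edge of the minimal subtree at the only vertex with nonabelian stabilizer over `w` had a
centralizer conjugate to that of the essential edge `{w, u}`, the subtree would lift to the
blow-up avoiding the edge at `w` given by this centralizer, and `G` would lie in the
side of `w`. -/
theorem exists_haveConjugateCentralizers (T : TreeAction H V) (hT : T.HasAbelianEdgeGroups)
    (hG : IsLimitGroup G) (hGi : IsFreelyIndecomposable G) (hH : IsLimitGroup H)
    (hHi : IsFreelyIndecomposable H) {η : G →* H} (hη : H1Injective η) {S : Set V} {w u : V}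
    (hS : T.IsMinimalSubtree η S) (hw : T.IsUniqueNonabelianOver η S w)
    (hwu : T.graph.Adj w u) (hess : T.IsEssentialEdge w u) :
    ∃ u' ∈ S, T.graph.Adj w u' ∧ T.HaveConjugateCentralizers w u u' := by
  by_contra! hno
  obtain ⟨hwS, hwn, huniq⟩ := hw
  have hG' : ∃ x y : G, x * y ≠ y * x := by
    obtain ⟨x, -, y, -, hxy⟩ := hwn
    exact ⟨x, y, hxy⟩
  have not_attach : ∀ y ∈ S, T.graph.Adj w y → ¬ ∃ k : H, T.attach w y = k • T.attach w u :=
    fun y hy hwy ⟨k, hk⟩ => hno y hy hwy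
      ⟨k, (congrArg VertexSubgroup.base hk).symm, congrArg VertexSubgroup.grp hk⟩
  have hturn : ∀ v y y' : V, v ∈ S → y ∈ S → y' ∈ S → T.graph.Adj v y → T.graph.Adj v y' →
      (∃ k : H, T.attach v y = k • T.attach w u) → T.attach v y' = T.attach v y := by
    rintro v y y' hv hy hy' hvy hvy' ⟨k, hk⟩
    by_cases hvn : IsNonabelian (T.inducedVertexGroup η v)
    · obtain ⟨g, rfl⟩ := huniq v hv ⟨k, (congrArg VertexSubgroup.base hk).symm⟩ hvn
      refine absurd ⟨(η g)⁻¹ * k, ?_⟩ (not_attach (η g⁻¹ • y) (hS.1.2 _ y hy) ?_)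
      · simpa using T.adj_smul (η g⁻¹) hvy
      · rw [mul_smul, ← hk, smul_attach, inv_smul_smul, map_inv]
    · exact hS.attach_eq hT hG hGi hG' hH hv hy hy' hvy hvy' hvn
  have hL : ∀ g, η g ∈ T.blowUp.sideGroup (Sum.inl w) (Sum.inr (T.attach w u)) (Sum.inl w) := by
    intro g
    obtain hfix | ⟨y, hy, hwy⟩ := hS.1.exists_adj hwS
    · exact T.blowUp.stabilizer_le_sideGroup _ _ _ (congrArg Sum.inl (hfix g))
    · have h1 := (T.blowUp_cutForest_adj_inl_inr (T.attach w u) (T.attach w y)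
        (not_attach y hy hwy)).reachable
      have h2 := T.blowUp_reachable_attach (T.attach w u) hS.1.1 hturn hwS hy (hS.1.2 g w hwS)
        (hS.1.2 g y hy) hwy (T.adj_smul _ hwy)
      have h3 := T.blowUp.cutForest_reachable_smul _ _ (η g) h1
      rw [Sum.smul_inr, smul_attach] at h3
      exact h1.trans (h2.trans h3.symm)
  refine T.blowUp.not_forall_mem_sideGroup hH hη (T.blowUpGraph_adj_inl_inr (T.attach w u))
    (not_isNonabelian_edgeGroup_blowUp hH hT hwu (hess.edgeGroup_ne_bot hwu hHi))
    (fun hsep' => ?_) hL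
  by_cases hsep : T.IsSeparatingEdge w u
  · exact Or.inr (T.blowUp_relIndex_sideGroup_eq_zero hwu hsep (hess.2.2 hsep).2)
  · obtain ⟨φ, hφ, hφA⟩ := T.exists_hom_int_of_blowUp_isSeparatingEdge hwu hsep hsep'
    exact absurd (hη (MonoidHom.ext fun g => hφA _ (hL g))) hφ

end TreeAction

theorem mainTheorem6 {G H : Type*} [Group G] [Group H]
    (hG : IsLimitGroup G) (hH : IsLimitGroup H)
    (hGi : IsFreelyIndecomposable G) (hHi : IsFreelyIndecomposable H)
    (η : G →* H) (hη : H1Injective η) :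
    (∀ (V : Type*) [MulAction H V] (T : TreeAction H V),
      T.IsEssentialOneEdgedAbelianSplitting → T.IsHyperbolic η) ∧
    (∀ (V : Type*) [MulAction H V] (Δ : GAD H V) (v : V),
      IsNonabelian (MulAction.stabilizer H v) →
        ∃ h : H, IsNonabelian ((conjSubgroup h (MulAction.stabilizer H v)).comap η)) ∧
    (∀ (V : Type*) [MulAction H V] (Δ : GAD H V) (S : Set V) (w : V),
      Δ.IsMinimalSubtree η S →
      IsNonabelian (MulAction.stabilizer H w) →
      Δ.IsUniqueNonabelianOver η S w →
        (∀ u : V, Δ.graph.Adj w u → Δ.IsEssentialEdge w u →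
          ∃ u' ∈ S, Δ.graph.Adj w u' ∧ Δ.HaveConjugateCentralizers w u u') ∧
        ((∀ u : V, Δ.graph.Adj w u → Δ.IsEssentialEdge w u) →
          Δ.HasNonconjugateCentralizersAt w → Δ.IsSubmersionAt S w)) := by
  refine ⟨fun V _ T hT => T.isHyperbolic_of_isEssential hH hη hT,
    fun V _ Δ v hv => Δ.exists_isNonabelian_comap Δ.abelian_edges hG hGi hH hη hv,
    fun V _ Δ S w hS _ hw => ?_⟩
  have key : ∀ u : V, Δ.graph.Adj w u → Δ.IsEssentialEdge w u →
      ∃ u' ∈ S, Δ.graph.Adj w u' ∧ Δ.HaveConjugateCentralizers w u u' := fun u hwu hess =>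
    Δ.exists_haveConjugateCentralizers Δ.abelian_edges hG hGi hH hHi hη hS hw hwu hess
  refine ⟨key, fun hess hnc u hwu => ?_⟩
  obtain ⟨u', hu', hwu', hconj⟩ := key u hwu (hess u hwu)
  obtain ⟨h, hw, rfl⟩ := hnc u u' hwu hwu' hconj
  exact ⟨h • u, hu', hwu', h⁻¹, inv_smul_eq_iff.2 hw.symm, inv_smul_smul h u⟩
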